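/- Call a function $B:[0,\infty)\to[0,\infty)$ a Young function if it is continuous, convex and strictly increasing, $B(0)=0$ and $B(t)/t\to\infty$ as $t\to\infty$; its associate is $\bar B(t)=\sup_{s>0}\{st-B(s)\}$. For $1<p<\infty$ write $\bar B\in B_p$ if $\int_1^\infty \frac{\bar B(t)}{t^p}\frac{dt}{t}<\infty$. Cubes $Q\subset\mathbb R^n$ have sides parallel to the coordinate axes. For such $Q$ put \[ \|f\|_{q,Q}=\Big(\frac1{|Q|}\int_Q|f|^q\,dx\Big)^{1/q},\qquad \|f\|_{B,Q}=\inf\Big\{\lambda>0:\ \frac1{|Q|}\int_Q B\Big(\frac{|f(x)|}{\lambda}\Big)dx\le 1\Big\}. \] For $0\le\alpha<n$ let \[ M_\alpha g(x)=\sup_{Q\ni x}|Q|^{\alpha/n}\,\frac1{|Q|}\int_Q|g(y)|\,dy . \] A weight is a non-negative (finite-valued) measurable function on $\mathbb R^n$ that is positive on a set of positive measure. For weights $u,\sigma$ and $1<p\le q<\infty$, with $p'=p/(p-1)$, let \[ [u,\sigma]_{A^\alpha_{p,q,B}}=\sup_Q |Q|^{\frac\alpha n+\frac1q-\frac1p}\,\|u^{1/q}\|_{q,Q}\,\|\sigma^{1/p'}\|_{B,Q},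 \] with the convention $0\cdot\infty=0$. Theorem. Let $n\ge1$, $1<p\le q<\infty$, and let $B$ be a Young function with $\bar B\in B_p$. There is a constant $C<\infty$, depending only on $n,p,q$ and $B$, such that for every $0\le\alpha<n$, every pair of weights $(u,\sigma)$ with $[u,\sigma]_{A^\alpha_{p,q,B}}<\infty$ and every $f\in L^p(\sigma)$, \[ \Big(\int_{\mathbb R^n}M_\alpha(f\sigma)(x)^q\,u(x)\,dx\Big)^{1/q}\le C\,[u,\sigma]_{A^\alpha_{p,q,B}}\Big(\int_{\mathbb R^n}|f(x)|^p\sigma(x)\,dx\Big)^{1/p}. \] -/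

import Mathlib

open MeasureTheory Set Filter Topology
open scoped NNReal ENNReal

noncomputable section

namespace TwoWeight

/-- The (half-open) cube in `ℝⁿ` with sides parallel to the axes, lower corner `a` and
side length `ℓ`. -/
def cube {n : ℕ} (a : Fin n → ℝ) (ℓ : ℝ) : Set (Fin n → ℝ) :=
  {x | ∀ i, a i ≤ x i ∧ x i < a i + ℓ}

/-- A weight: a nonnegative Lebesgue measurable function that is positive on a set of positive
measure. -/
structure IsWeight {n : ℕ} (w : (Fin n → ℝ) → ℝ≥0) : Prop where
  aemeasurable : AEMeasurable w volume
  pos : 0 < volume {x | 0 < w x}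

/-- The measure `dσ = σ dx`. -/
def weightMeasure {n : ℕ} (σ : (Fin n → ℝ) → ℝ≥0) : Measure (Fin n → ℝ) :=
  volume.withDensity (fun x => (σ x : ℝ≥0∞))

/-- The fractional maximal function
`M_α g (x) = sup_{Q ∋ x} |Q|^{α/n} ⨍_Q |g|`, the supremum being over all cubes that contain `x`;
`α = 0` is the Hardy-Littlewood maximal function. -/
def fracMaximal {n : ℕ} (α : ℝ) (g : (Fin n → ℝ) → ℝ) (x : Fin n → ℝ) : ℝ≥0∞ :=
  ⨆ (a : Fin n → ℝ) (ℓ : ℝ) (_ : 0 < ℓ) (_ : x ∈ cube a ℓ),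
    volume (cube a ℓ) ^ (α / n) * ⨍⁻ y in cube a ℓ, ‖g y‖ₑ ∂volume

/-- Young functions `B : [0,∞) → [0,∞)`. -/
structure IsYoungFunction (B : ℝ≥0 → ℝ≥0) : Prop where
  continuous : Continuous B
  convexOn : ConvexOn ℝ≥0 univ B
  strictMono : StrictMono B
  map_zero : B 0 = 0
  tendsto_div : Tendsto (fun t => B t / t) atTop atTop

/-- The associate function `B̄(t) = sup_{s > 0} (s t - B(s))`. The supremum is never negative
(let `s → 0`), so that nothing is lost by cutting off the negative terms. -/
def associate (B : ℝ≥0 → ℝ≥0) (t : ℝ≥0) : ℝ≥0∞ :=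
  ⨆ (s : ℝ≥0) (_ : 0 < s), ENNReal.ofReal ((s : ℝ) * t - B s)

/-- The `B_p` growth condition `∫_1^∞ Φ(t) / t^p dt / t < ∞`. -/
def SatisfiesBp (Φ : ℝ≥0 → ℝ≥0∞) (p : ℝ) : Prop :=
  ∫⁻ t in Ioi (1 : ℝ), Φ t.toNNReal / ENNReal.ofReal (t ^ p) / ENNReal.ofReal t < ∞

/-- The normalized local norm `‖f‖_{r,Q} = (⨍_Q |f|^r)^{1/r}`. -/
def normLp {n : ℕ} (r : ℝ) (Q : Set (Fin n → ℝ)) (f : (Fin n → ℝ) → ℝ) : ℝ≥0∞ :=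
  (⨍⁻ x in Q, ‖f x‖ₑ ^ r ∂volume) ^ (1 / r)

/-- The normalized Luxemburg norm `‖f‖_{B,Q} = inf {c > 0 : ⨍_Q B(|f| / c) ≤ 1}`, equal to `∞`
if there is no such `c`. -/
def luxemburgNorm {n : ℕ} (B : ℝ≥0 → ℝ≥0) (Q : Set (Fin n → ℝ)) (f : (Fin n → ℝ) → ℝ) : ℝ≥0∞ :=
  ⨅ (c : ℝ≥0) (_ : 0 < c) (_ : ⨍⁻ x in Q, (B (‖f x‖₊ / c) : ℝ≥0∞) ∂volume ≤ 1), (c : ℝ≥0∞)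

/-- The bump constant
`[u,σ] = sup_Q |Q|^{α/n + 1/q - 1/p} ‖u^{1/q}‖_{q,Q} ‖σ^{1/p'}‖_{B,Q}`, where `1/p + 1/p' = 1`. -/
def bumpConst {n : ℕ} (α p q : ℝ) (B : ℝ≥0 → ℝ≥0) (u σ : (Fin n → ℝ) → ℝ≥0) : ℝ≥0∞ :=
  ⨆ (a : Fin n → ℝ) (ℓ : ℝ) (_ : 0 < ℓ),
    volume (cube a ℓ) ^ (α / n + 1 / q - 1 / p)
      * normLp q (cube a ℓ) (fun x => (u x : ℝ) ^ (1 / q))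
      * luxemburgNorm B (cube a ℓ) (fun x => (σ x : ℝ) ^ (1 / p.conjExponent))

end TwoWeight

end

/-! Factor `|f| σ = h s` with `h = |f| σ^{1/p}` and `s = σ^{1/p'}`, so that `∫ h^p = ∫ |f|^p σ`. On
a cube `Q`, Young's inequality for `B` and its associate bounds the average of `h s` by the product
of the `B`-norm of `s` and the `B̄`-norm of `h`. After multiplication by `|Q|^{α/n}` and
`u(5Q)^{1/q}`, the bump constant absorbs `s` and `u`, and only `‖h‖_{B̄,Q} |Q|^{1/p}` is left
(`fracAvg_rpow_mul_le`). The norms of `u` and `s` are taken over `5Q` because Vitali selection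
covers by fivefold enlargements.

Let `M` denote the maximal function of `h s`. Each layer `a^k < M ≤ a^{k+1}` is covered by
enlargements of disjoint cubes `Q` whose fractional averages exceed `a^k` and which meet `{M ≤
a^{k+1}}`. A localized weak-type estimate shows that `E = Q \ {M > a^{k+2}}` fills at least half of
`Q` (`two_mul_volume_inter_superlevel_le`), and over all levels these sets overlap at most twice.
Since `q ≥ p`, the sum of `q/p`-th powers is at most the `q/p`-th power of the sum
(`lintegral_maxFun_rpow_mul_le`).

It remains to bound `∑ ‖h‖_{B̄,Q}^p |E|` by `∫ h^p`, and here the `B_p` condition enters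
(`tsum_orliczNorm_rpow_mul_le`). A cube with norm above `t` has volume at most twice the integral
over it of `B̄(h/t)` on `{h > ct}`. Vitali at each height `t`, followed by integration against `p
t^{p-1} dt`, yields `∫ h^p` times a tail of the `B_p` integral. The integrability of `h s` used for
the selection is removed by truncating to large cubes and monotone convergence. -/

namespace TwoWeight

/-! ### Cubes and Vitali covering -/

variable {n : ℕ}

lemma cube_eq_pi (a : Fin n → ℝ) (ℓ : ℝ) :
    cube a ℓ = Set.pi univ (fun i => Ico (a i) (a i + ℓ)) := by
  ext x; simp [cube, Set.mem_pi]

lemma measurableSet_cube (a : Fin n → ℝ) (ℓ : ℝ) : MeasurableSet (cube a ℓ) := by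
  rw [cube_eq_pi]
  exact MeasurableSet.univ_pi fun i => measurableSet_Ico

lemma volume_cube (a : Fin n → ℝ) (ℓ : ℝ) : volume (cube a ℓ) = ENNReal.ofReal ℓ ^ n := by
  rw [cube_eq_pi, Real.volume_pi_Ico]
  simp

lemma volume_cube_pos (a : Fin n → ℝ) {ℓ : ℝ} (hℓ : 0 < ℓ) : 0 < volume (cube a ℓ) := by
  rw [volume_cube]
  exact ENNReal.pow_pos (by simpa using hℓ) n

lemma volume_cube_ne_top (a : Fin n → ℝ) (ℓ : ℝ) : volume (cube a ℓ) ≠ ∞ := by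
  rw [volume_cube]
  exact ENNReal.pow_ne_top ENNReal.ofReal_ne_top

/-- The concentric cube with five times the side length. -/
def quint (c : (Fin n → ℝ) × ℝ) : (Fin n → ℝ) × ℝ := (fun i => c.1 i - 2 * c.2, 5 * c.2)

lemma quint_pos {c : (Fin n → ℝ) × ℝ} (hc : 0 < c.2) : 0 < (quint c).2 := by
  simpa [quint] using hc

lemma volume_quint (c : (Fin n → ℝ) × ℝ) :
    volume (cube (quint c).1 (quint c).2) = 5 ^ n * volume (cube c.1 c.2) := by
  rw [volume_cube, volume_cube, quint, ENNReal.ofReal_mul (by norm_num), mul_pow]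
  simp

lemma cube_subset_quint_of_inter {c b : (Fin n → ℝ) × ℝ}
    (h : (cube c.1 c.2 ∩ cube b.1 b.2).Nonempty) (hcb : c.2 ≤ 2 * b.2) :
    cube c.1 c.2 ⊆ cube (quint b).1 (quint b).2 := by
  obtain ⟨z, hz, hz'⟩ := h
  intro x hx i
  have h1 := hx i
  have h2 := hz i
  have h3 := hz' i
  simp only [quint]
  constructor <;> linarith

lemma cube_subset_quint {c : (Fin n → ℝ) × ℝ} (hc : 0 < c.2) :
    cube c.1 c.2 ⊆ cube (quint c).1 (quint c).2 := by
  intro x hx i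
  have h1 := hx i
  simp only [quint]
  constructor <;> linarith

lemma cube_nonempty (a : Fin n → ℝ) {ℓ : ℝ} (hℓ : 0 < ℓ) : (cube a ℓ).Nonempty :=
  ⟨a, fun i => ⟨le_rfl, by linarith⟩⟩

lemma exists_disjoint_subfamily (S : Set ((Fin n → ℝ) × ℝ)) (hS : ∀ c ∈ S, 0 < c.2)
    (R : ℝ) (hR : ∀ c ∈ S, c.2 ≤ R) :
    ∃ U ⊆ S, U.Countable ∧ U.PairwiseDisjoint (fun c => cube c.1 c.2) ∧
      ∀ c ∈ S, ∃ b ∈ U, cube c.1 c.2 ⊆ cube (quint b).1 (quint b).2 := by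
  obtain ⟨U, hUS, hdis, hcov⟩ := Vitali.exists_disjoint_subfamily_covering_enlargement
    (fun c : (Fin n → ℝ) × ℝ => cube c.1 c.2) S (fun c => c.2) 2 one_lt_two
    (fun c hc => (hS c hc).le) R hR (fun c hc => cube_nonempty _ (hS c hc))
  refine ⟨U, hUS, ?_, hdis, fun c hc => ?_⟩
  · refine hdis.countable_of_nonempty_interior fun c hc => ?_
    refine ⟨fun i => c.1 i + c.2 / 2, ?_⟩
    have hpos := hS c (hUS hc)
    rw [mem_interior]
    refine ⟨Set.pi univ (fun i => Ioo (c.1 i) (c.1 i + c.2)), ?_,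
      isOpen_set_pi finite_univ fun i _ => isOpen_Ioo, ?_⟩
    · rw [cube_eq_pi]
      exact Set.pi_mono fun i _ => Ioo_subset_Ico_self
    · intro i _
      constructor <;> simp <;> linarith
  · obtain ⟨b, hb, hne, hle⟩ := hcov c hc
    exact ⟨b, hb, cube_subset_quint_of_inter hne hle⟩

lemma exists_side_bound [NeZero n] {S : Set ((Fin n → ℝ) × ℝ)} {V : ℝ≥0∞} (hV : V ≠ ∞)
    (h : ∀ c ∈ S, volume (cube c.1 c.2) ≤ V) : ∃ R : ℝ, ∀ c ∈ S, c.2 ≤ R := by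
  refine ⟨max 1 V.toReal, fun c hc => ?_⟩
  by_contra! hlt
  obtain ⟨h1, h2⟩ := max_lt_iff.1 hlt
  have h3 := h c hc
  rw [volume_cube, ← ENNReal.ofReal_pow (by linarith), ENNReal.ofReal_le_iff_le_toReal hV] at h3
  have := le_self_pow₀ h1.le (NeZero.ne n)
  linarith

/-- A Vitali covering estimate for a family of cubes on which a measure dominates the volume. -/
lemma volume_biUnion_cube_le [NeZero n] (S : Set ((Fin n → ℝ) × ℝ)) (hS : ∀ c ∈ S, 0 < c.2)
    (μ : Measure (Fin n → ℝ)) (hμ : ∀ c ∈ S, volume (cube c.1 c.2) ≤ μ (cube c.1 c.2)) :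
    volume (⋃ c ∈ S, cube c.1 c.2) ≤ 5 ^ n * μ univ := by
  -- If `μ` is finite, it bounds all the volumes, hence the side lengths, as Vitali selection
  -- requires.
  by_cases htop : μ univ = ∞
  · simp [htop]
  obtain ⟨R, hR⟩ := exists_side_bound htop fun c hc => (hμ c hc).trans (measure_mono (subset_univ _))
  obtain ⟨U, hUS, hUc, hdis, hcov⟩ := exists_disjoint_subfamily S hS R hR
  calc volume (⋃ c ∈ S, cube c.1 c.2)
      ≤ volume (⋃ c ∈ U, cube (quint c).1 (quint c).2) := by
        refine measure_mono (iUnion₂_subset fun c hc => ?_)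
        obtain ⟨b, hb, hsub⟩ := hcov c hc
        exact hsub.trans (subset_biUnion_of_mem (u := fun c => cube (quint c).1 (quint c).2) hb)
    _ ≤ ∑' c : U, volume (cube (quint c.1).1 (quint c.1).2) := measure_biUnion_le _ hUc _
    _ ≤ ∑' c : U, 5 ^ n * μ (cube c.1.1 c.1.2) := by
        refine ENNReal.tsum_le_tsum fun c => ?_
        rw [volume_quint]
        exact mul_le_mul_right (hμ c.1 (hUS c.2)) _
    _ = 5 ^ n * μ (⋃ c ∈ U, cube c.1 c.2) := by
        rw [ENNReal.tsum_mul_left, measure_biUnion hUc hdis fun c _ => measurableSet_cube _ _]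
    _ ≤ _ := by gcongr; exact subset_univ _

/-! ### The fractional maximal function -/

/-- The fractional average `|Q|^{α/n} ⨍_Q G`. -/
noncomputable def fracAvg (α : ℝ) (G : (Fin n → ℝ) → ℝ≥0∞) (c : (Fin n → ℝ) × ℝ) : ℝ≥0∞ :=
  volume (cube c.1 c.2) ^ (α / n) * ⨍⁻ y in cube c.1 c.2, G y ∂volume

/-- The fractional maximal function of a function with values in `[0,∞]`. -/
noncomputable def maxFun (α : ℝ) (G : (Fin n → ℝ) → ℝ≥0∞) (x : Fin n → ℝ) : ℝ≥0∞ :=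
  ⨆ (c : (Fin n → ℝ) × ℝ) (_ : 0 < c.2) (_ : x ∈ cube c.1 c.2), fracAvg α G c

lemma fracMaximal_eq_maxFun (α : ℝ) (g : (Fin n → ℝ) → ℝ) (x : Fin n → ℝ) :
    fracMaximal α g x = maxFun α (fun y => ‖g y‖ₑ) x := by
  simp only [fracMaximal, maxFun, fracAvg, iSup_prod]

lemma fracAvg_eq (α : ℝ) (G : (Fin n → ℝ) → ℝ≥0∞) (c : (Fin n → ℝ) × ℝ) :
    fracAvg α G c = volume (cube c.1 c.2) ^ (α / n) * (volume (cube c.1 c.2))⁻¹ *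
      ∫⁻ y in cube c.1 c.2, G y := by
  rw [fracAvg, setLAverage_eq, ENNReal.div_eq_inv_mul, mul_assoc]

lemma fracAvg_le_maxFun {α : ℝ} {G : (Fin n → ℝ) → ℝ≥0∞} {c : (Fin n → ℝ) × ℝ} (hc : 0 < c.2)
    {x : Fin n → ℝ} (hx : x ∈ cube c.1 c.2) : fracAvg α G c ≤ maxFun α G x :=
  le_iSup₂_of_le c hc (le_iSup_of_le hx le_rfl)

lemma lt_maxFun_iff {α : ℝ} {G : (Fin n → ℝ) → ℝ≥0∞} {t : ℝ≥0∞} {x : Fin n → ℝ} :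
    t < maxFun α G x ↔ ∃ c : (Fin n → ℝ) × ℝ, 0 < c.2 ∧ x ∈ cube c.1 c.2 ∧ t < fracAvg α G c := by
  simp only [maxFun, lt_iSup_iff, exists_prop]

/-- Enlarging a cube by a small `ε` on every side makes it a neighbourhood of its points. Keeping
the integral over the old cube as a lower bound, the average changes continuously with `ε` and stays
above `t`. No measurability of `G` is needed. -/
lemma isOpen_lt_maxFun (α : ℝ) (G : (Fin n → ℝ) → ℝ≥0∞) (t : ℝ≥0∞) :
    IsOpen {x | t < maxFun α G x} := by
  rw [isOpen_iff_mem_nhds]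
  intro x hx
  obtain ⟨⟨a, ℓ⟩, hℓ, hxc, hlt⟩ := lt_maxFun_iff.1 hx
  simp only at hℓ hxc
  rw [fracAvg_eq] at hlt
  have hv0 : ∀ ε : ℝ, 0 ≤ ε → ENNReal.ofReal (ℓ + 2 * ε) ^ n ≠ 0 := fun ε hε =>
    (ENNReal.pow_pos (by rw [ENNReal.ofReal_pos]; linarith) n).ne'
  have hcont : Tendsto (fun ε : ℝ => (ENNReal.ofReal (ℓ + 2 * ε) ^ n) ^ (α / n) *
      (ENNReal.ofReal (ℓ + 2 * ε) ^ n)⁻¹ * ∫⁻ y in cube a ℓ, G y) (𝓝[>] 0)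
      (𝓝 ((ENNReal.ofReal (ℓ + 2 * 0) ^ n) ^ (α / n) *
      (ENNReal.ofReal (ℓ + 2 * 0) ^ n)⁻¹ * ∫⁻ y in cube a ℓ, G y)) := by
    have h1 : Tendsto (fun ε : ℝ => ENNReal.ofReal (ℓ + 2 * ε) ^ n) (𝓝[>] 0)
        (𝓝 (ENNReal.ofReal (ℓ + 2 * 0) ^ n)) := by
      refine Tendsto.mono_left ?_ nhdsWithin_le_nhds
      have : Continuous fun ε : ℝ => ENNReal.ofReal (ℓ + 2 * ε) ^ n :=
        (ENNReal.continuous_pow n).comp (ENNReal.continuous_ofReal.comp (by fun_prop))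
      exact this.tendsto 0
    have hne0 := hv0 0 le_rfl
    have hnet : ENNReal.ofReal (ℓ + 2 * 0) ^ n ≠ ∞ := ENNReal.pow_ne_top ENNReal.ofReal_ne_top
    have hr0 := (ENNReal.rpow_pos (pos_iff_ne_zero.2 hne0) hnet (p := α / n)).ne'
    have hrt := ENNReal.rpow_ne_top_of_ne_zero hne0 hnet (y := α / n)
    refine ENNReal.Tendsto.mul_const (ENNReal.Tendsto.mul ?_ (Or.inl hr0) ?_ (Or.inr hrt))
      (Or.inl (mul_ne_zero hr0 (ENNReal.inv_ne_zero.2 hnet)))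
    · exact ((ENNReal.continuous_rpow_const (y := α / n)).tendsto _).comp h1
    · exact (continuous_inv.tendsto _).comp h1
  simp only [volume_cube] at hlt
  rw [mul_zero, add_zero] at hcont
  obtain ⟨ε, hεt, hε⟩ := ((hcont.eventually (lt_mem_nhds hlt)).and self_mem_nhdsWithin).exists
  refine mem_of_superset (IsOpen.mem_nhds (s := Set.pi univ
    (fun i => Ioo (a i - ε) (a i + ℓ + ε))) (isOpen_set_pi finite_univ fun i _ => isOpen_Ioo)
    fun i _ => ?_) fun y hy => ?_
  · have := hxc i
    constructor <;> linarith
  · refine lt_maxFun_iff.2 ⟨(fun i => a i - ε, ℓ + 2 * ε), by simp only; linarith, fun i => ?_, ?_⟩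
    · have := hy i (mem_univ i)
      simp only [mem_Ioo] at this
      simp only
      constructor <;> linarith
    · rw [fracAvg_eq]
      simp only [volume_cube]
      refine hεt.trans_le ?_
      gcongr
      intro y hy i
      have := hy i
      constructor <;> linarith

lemma measurable_maxFun (α : ℝ) (G : (Fin n → ℝ) → ℝ≥0∞) : Measurable (maxFun α G) :=
  measurable_of_Ioi fun t => (isOpen_lt_maxFun α G t).measurableSet

/-! ### The associate function near zero -/

lemma associate_mono (B : ℝ≥0 → ℝ≥0) : Monotone (associate B) := by
  intro t t' h
  refine iSup₂_mono fun s _ => ENNReal.ofReal_le_ofReal ?_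
  have : (t : ℝ) ≤ t' := h
  have := mul_le_mul_of_nonneg_left this s.coe_nonneg
  linarith

/-- Young's inequality for a function and its associate. -/
lemma mul_le_add_associate (B : ℝ≥0 → ℝ≥0) (s t : ℝ≥0) :
    (s : ℝ≥0∞) * t ≤ B s + associate B t := by
  rcases eq_or_ne s 0 with rfl | hs
  · simp
  · have h : ENNReal.ofReal ((s : ℝ) * t - B s) ≤ associate B t :=
      le_iSup₂_of_le s (pos_iff_ne_zero.2 hs) le_rfl
    calc (s : ℝ≥0∞) * t = ENNReal.ofReal ((s : ℝ) * t) := by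
          rw [ENNReal.ofReal_mul s.coe_nonneg, ENNReal.ofReal_coe_nnreal, ENNReal.ofReal_coe_nnreal]
      _ ≤ ENNReal.ofReal (B s + ((s : ℝ) * t - B s)) := by
          apply ENNReal.ofReal_le_ofReal; linarith
      _ ≤ ENNReal.ofReal (B s) + ENNReal.ofReal ((s : ℝ) * t - B s) := ENNReal.ofReal_add_le
      _ ≤ _ := by rw [ENNReal.ofReal_coe_nnreal]; gcongr

/-- Superlinear growth makes `s - B(s)` nonpositive beyond some `s₀`, so the supremum is at most
`s₀`. -/
lemma associate_one_lt_top {B : ℝ≥0 → ℝ≥0} (hB : Tendsto (fun t => B t / t) atTop atTop) :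
    associate B 1 < ∞ := by
  obtain ⟨s₀, hs₀⟩ := (hB.eventually_ge_atTop 1).exists_forall_of_atTop
  refine lt_of_le_of_lt (b := (s₀ : ℝ≥0∞)) (iSup₂_le fun s hs => ?_) ENNReal.coe_lt_top
  rw [← ENNReal.ofReal_coe_nnreal]
  apply ENNReal.ofReal_le_ofReal
  rcases le_total s₀ s with h | h
  · have h1 := hs₀ s h
    rw [one_le_div hs] at h1
    have h2 : (s : ℝ) ≤ B s := h1
    have := s₀.coe_nonneg
    simp only [NNReal.coe_one]
    linarith
  · have h2 : (s : ℝ) ≤ s₀ := h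
    have := (B s).coe_nonneg
    simp only [NNReal.coe_one]
    linarith

lemma associate_le_mul (B : ℝ≥0 → ℝ≥0) {ε : ℝ≥0} (hε : ε ≤ 1) :
    associate B ε ≤ ε * associate B 1 := by
  refine iSup₂_le fun s hs => ?_
  calc ENNReal.ofReal ((s : ℝ) * ε - B s) ≤ ENNReal.ofReal (ε * ((s : ℝ) * 1 - B s)) := by
        apply ENNReal.ofReal_le_ofReal
        have h1 : (ε : ℝ) ≤ 1 := hε
        nlinarith [(B s).coe_nonneg]
    _ = ε * ENNReal.ofReal ((s : ℝ) * (1 : ℝ≥0) - B s) := by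
        rw [ENNReal.ofReal_mul ε.coe_nonneg, ENNReal.ofReal_coe_nnreal, NNReal.coe_one]
    _ ≤ _ := by
        gcongr
        exact le_iSup₂_of_le s hs le_rfl

/-- Supplies the truncation height: values of `h/t` below `c` contribute at most half of the
critical average `1`. -/
lemma exists_associate_le_half {B : ℝ≥0 → ℝ≥0}
    (hB : Tendsto (fun t => B t / t) atTop atTop) :
    ∃ c : ℝ≥0, 0 < c ∧ c ≤ 1 ∧ associate B c ≤ 2⁻¹ := by
  lift associate B 1 to ℝ≥0 using (associate_one_lt_top hB).ne with b hb
  have hpos : 0 < 2 * (b + 1) := by positivity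
  refine ⟨(2 * (b + 1))⁻¹, by positivity, ?_, ?_⟩
  · apply inv_le_one_of_one_le₀
    calc (1 : ℝ≥0) ≤ 2 * 1 := by norm_num
      _ ≤ _ := by gcongr; exact le_add_self
  · refine (associate_le_mul B ?_).trans ?_
    · apply inv_le_one_of_one_le₀
      calc (1 : ℝ≥0) ≤ 2 * 1 := by norm_num
        _ ≤ _ := by gcongr; exact le_add_self
    · rw [← hb, ← ENNReal.coe_mul]
      have : (2 * (b + 1))⁻¹ * b ≤ (2 : ℝ≥0)⁻¹ := by
        rw [mul_inv, mul_assoc]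
        apply mul_le_of_le_one_right (by positivity)
        rw [inv_mul_le_iff₀ (by positivity), mul_one]
        exact le_self_add
      calc (((2 * (b + 1))⁻¹ * b : ℝ≥0) : ℝ≥0∞) ≤ ((2 : ℝ≥0)⁻¹ : ℝ≥0) :=
            ENNReal.coe_le_coe.2 this
        _ = _ := by rw [ENNReal.coe_inv two_ne_zero]; rfl

/-! ### Local Orlicz norms and the Carleson embedding -/

/-- The tail integral `∫_c^∞ Φ(s) s^{-p-1} ds`. -/
noncomputable def tailInt (Φ : ℝ≥0 → ℝ≥0∞) (p : ℝ) (c : ℝ≥0) : ℝ≥0∞ :=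
  ∫⁻ s in Ioi (c : ℝ), Φ s.toNNReal * ENNReal.ofReal (s ^ (-p - 1))

lemma tailInt_lt_top {Φ : ℝ≥0 → ℝ≥0∞} {p : ℝ} (hp : 0 < p) (hmono : Monotone Φ)
    (h1 : Φ 1 < ∞) (hΦ : SatisfiesBp Φ p) {c : ℝ≥0} (hc : 0 < c) (hc1 : c ≤ 1) :
    tailInt Φ p c < ∞ := by
  have hc' : (c : ℝ) ≤ 1 := hc1
  have hc0 : (0 : ℝ) < c := hc
  rw [tailInt, ← Ioc_union_Ioi_eq_Ioi hc', lintegral_union measurableSet_Ioi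
    (Ioc_disjoint_Ioi le_rfl)]
  refine ENNReal.add_lt_top.2 ⟨?_, ?_⟩
  · calc ∫⁻ s in Ioc (c : ℝ) 1, Φ s.toNNReal * ENNReal.ofReal (s ^ (-p - 1))
        ≤ ∫⁻ s in Ioc (c : ℝ) 1, Φ 1 * ENNReal.ofReal ((c : ℝ) ^ (-p - 1)) := by
          refine setLIntegral_mono' measurableSet_Ioc fun s hs => ?_
          refine mul_le_mul' (hmono (by simpa using hs.2)) (ENNReal.ofReal_le_ofReal ?_)
          exact Real.rpow_le_rpow_of_nonpos hc0 hs.1.le (by linarith)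
      _ < ∞ := by
          rw [setLIntegral_const]
          exact ENNReal.mul_lt_top (ENNReal.mul_lt_top h1 ENNReal.ofReal_lt_top) (by simp)
  · refine lt_of_le_of_lt (setLIntegral_mono' measurableSet_Ioi fun s hs => ?_) hΦ
    have hs0 : (0 : ℝ) < s := zero_lt_one.trans hs
    rw [div_eq_mul_inv, div_eq_mul_inv, ← ENNReal.ofReal_inv_of_pos (by positivity),
      ← ENNReal.ofReal_inv_of_pos hs0, mul_assoc, ← ENNReal.ofReal_mul (by positivity),
      Real.rpow_sub hs0, Real.rpow_one, Real.rpow_neg hs0.le, div_eq_mul_inv]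

/-- The normalized Luxemburg norm of a function with values in `[0,∞)`, for a gauge `Φ` with
values in `[0,∞]`. -/
noncomputable def orliczNorm {n : ℕ} (Φ : ℝ≥0 → ℝ≥0∞) (Q : Set (Fin n → ℝ))
    (h : (Fin n → ℝ) → ℝ≥0) : ℝ≥0∞ :=
  ⨅ (c : ℝ≥0) (_ : 0 < c) (_ : ⨍⁻ x in Q, Φ (h x / c) ∂volume ≤ 1), (c : ℝ≥0∞)

/-- The part of `Φ(h/t)` where `h > c t`. -/
noncomputable def truncGauge (Φ : ℝ≥0 → ℝ≥0∞) (c y t : ℝ≥0) : ℝ≥0∞ :=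
  if c * t < y then Φ (y / t) else 0

/-- A height `t` below the norm is not admissible, so `Φ(h/t)` has average above `1`. Points with `h
≤ ct` account for at most `1/2` of it, and the truncated part carries the rest. -/
lemma volume_cube_le_of_lt_orliczNorm {Φ : ℝ≥0 → ℝ≥0∞} (hmono : Monotone Φ) {c t : ℝ≥0}
    (hc : Φ c ≤ 2⁻¹) (ht : 0 < t) {h : (Fin n → ℝ) → ℝ≥0} {a : Fin n → ℝ} {ℓ : ℝ}
    (hℓ : 0 < ℓ) (hlt : (t : ℝ≥0∞) < orliczNorm Φ (cube a ℓ) h) :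
    volume (cube a ℓ) ≤ 2 * ∫⁻ x in cube a ℓ, truncGauge Φ c (h x) t := by
  have hv0 := (volume_cube_pos a hℓ).ne'
  have hvt := volume_cube_ne_top a ℓ
  set v := volume (cube a ℓ) with hv
  have h1 : ¬ ⨍⁻ x in cube a ℓ, Φ (h x / t) ∂volume ≤ 1 := fun hle =>
    absurd hlt (not_lt.2 (iInf₂_le_of_le t ht (iInf_le_of_le hle le_rfl)))
  rw [not_le, setLAverage_eq, ENNReal.lt_div_iff_mul_lt (Or.inl hv0) (Or.inl hvt), one_mul] at h1
  have h2 : ∫⁻ x in cube a ℓ, Φ (h x / t) ≤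
      (∫⁻ x in cube a ℓ, truncGauge Φ c (h x) t) + 2⁻¹ * v := by
    rw [hv, ← setLIntegral_const, ← lintegral_add_right _ measurable_const]
    refine lintegral_mono fun x => ?_
    simp only [truncGauge]
    split_ifs with hx
    · exact le_self_add
    · rw [zero_add]
      refine (hmono ?_).trans hc
      rw [div_le_iff₀ ht]
      exact not_lt.1 hx
  have h3 : v = 2⁻¹ * v + 2⁻¹ * v := by
    rw [← add_mul, ENNReal.inv_two_add_inv_two, one_mul]
  have hfin : 2⁻¹ * v ≠ ∞ := ENNReal.mul_ne_top (by simp) hvt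
  have h4 : 2⁻¹ * v ≤ ∫⁻ x in cube a ℓ, truncGauge Φ c (h x) t := by
    refine ENNReal.le_of_add_le_add_right hfin ?_
    rw [← h3]
    exact h1.le.trans h2
  calc v = 2 * (2⁻¹ * v) := by
        rw [← mul_assoc, ENNReal.mul_inv_cancel two_ne_zero ENNReal.ofNat_ne_top, one_mul]
    _ ≤ _ := by gcongr

lemma lintegral_truncGauge {Φ : ℝ≥0 → ℝ≥0∞} {p : ℝ} (hp : 0 < p) {c : ℝ≥0} (hc : 0 < c) (y : ℝ≥0) :
    ∫⁻ t in Ioi (0 : ℝ), ENNReal.ofReal (t ^ (p - 1)) * truncGauge Φ c y t.toNNReal =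
      (y : ℝ≥0∞) ^ p * tailInt Φ p c := by
  rcases eq_or_ne y 0 with rfl | hy
  · simp [truncGauge, ENNReal.zero_rpow_of_pos hp]
  have hy0 : (0 : ℝ) < y := NNReal.coe_pos.2 (pos_iff_ne_zero.2 hy)
  have hc0 : (0 : ℝ) < c := hc
  -- The substitution `t = y/s` turns the truncation `ct < y` into `s > c` and pulls out the factor
  -- `y^p`.
  have himg : (fun s : ℝ => (y : ℝ) / s) '' Ioi (c : ℝ) = Ioo 0 ((y : ℝ) / c) := by
    ext t
    simp only [mem_image, mem_Ioi, mem_Ioo]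
    constructor
    · rintro ⟨s, hs, rfl⟩
      have := hc0.trans hs
      exact ⟨by positivity, by gcongr⟩
    · rintro ⟨h0, h1⟩
      refine ⟨y / t, ?_, by field_simp⟩
      rw [lt_div_iff₀ hc0] at h1
      rw [lt_div_iff₀ h0]
      linarith
  have h1 : ∫⁻ t in Ioi (0 : ℝ), ENNReal.ofReal (t ^ (p - 1)) * truncGauge Φ c y t.toNNReal =
      ∫⁻ t in Ioo 0 ((y : ℝ) / c), ENNReal.ofReal (t ^ (p - 1)) * Φ (y / t.toNNReal) := by
    rw [← lintegral_indicator measurableSet_Ioi, ← lintegral_indicator measurableSet_Ioo]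
    congr 1
    ext t
    simp only [indicator, mem_Ioi, mem_Ioo, truncGauge]
    by_cases ht : 0 < t
    · have hiff : c * t.toNNReal < y ↔ t < y / c := by
        rw [← NNReal.coe_lt_coe, NNReal.coe_mul, Real.coe_toNNReal t ht.le, lt_div_iff₀ hc0, mul_comm]
      simp only [ht, if_true, true_and, hiff]
      split_ifs <;> simp
    · simp [ht]
  rw [h1, ← himg, lintegral_image_eq_lintegral_abs_deriv_mul (f' := fun s => -(y : ℝ) / s ^ 2)
    measurableSet_Ioi, tailInt, ← lintegral_const_mul' _ _
      (ENNReal.rpow_ne_top_of_nonneg hp.le ENNReal.coe_ne_top)]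
  · refine setLIntegral_congr_fun measurableSet_Ioi fun s hs => ?_
    have hs0 : (0 : ℝ) < s := hc0.trans hs
    have e1 : y / ((y : ℝ) / s).toNNReal = s.toNNReal := by
      ext
      rw [NNReal.coe_div, Real.coe_toNNReal _ (by positivity), Real.coe_toNNReal _ hs0.le]
      field_simp
    have e2 : (y : ℝ≥0∞) ^ p = ENNReal.ofReal ((y : ℝ) ^ p) := by
      rw [← ENNReal.ofReal_rpow_of_pos hy0, ENNReal.ofReal_coe_nnreal]
    simp only [e1, e2]
    rw [← mul_assoc, ← ENNReal.ofReal_mul (abs_nonneg _), mul_comm (Φ _), ← mul_assoc,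
      ← ENNReal.ofReal_mul (by positivity)]
    congr 2
    rw [abs_div, abs_neg, abs_of_pos hy0, abs_of_pos (by positivity), Real.div_rpow hy0.le hs0.le,
      Real.rpow_sub hy0, Real.rpow_sub hs0, Real.rpow_sub hs0, Real.rpow_neg hs0.le, Real.rpow_one,
      Real.rpow_one]
    field_simp
  · intro s hs
    have hs0 : s ≠ 0 := (hc0.trans hs).ne'
    have := ((hasDerivAt_const s (y : ℝ)).div (hasDerivAt_id s) hs0)
    simp only [id, zero_mul, mul_one, zero_sub] at this
    exact this.hasDerivWithinAt
  · intro s hs s' hs' he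
    have hs0 : s ≠ 0 := (hc0.trans hs).ne'
    have hs0' : s' ≠ 0 := (hc0.trans hs').ne'
    simp only at he
    field_simp at he
    exact he.symm

/-- Layer cake for a single number, allowing `N = ∞`, since finiteness of the Orlicz norm is itself
deduced from the embedding. -/
lemma rpow_le_lintegral_layer {p : ℝ} (hp : 0 < p) (N : ℝ≥0∞) :
    N ^ p ≤ ∫⁻ t in Ioi (0 : ℝ),
      {t : ℝ | ENNReal.ofReal t < N}.indicator (fun t => ENNReal.ofReal (p * t ^ (p - 1))) t := by
  have key : ∀ b : ℝ≥0, (b : ℝ≥0∞) ≤ N → (b : ℝ≥0∞) ^ p ≤ ∫⁻ t in Ioi (0 : ℝ),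
      {t : ℝ | ENNReal.ofReal t < N}.indicator (fun t => ENNReal.ofReal (p * t ^ (p - 1))) t := by
    intro b hb
    have hI : IntervalIntegrable (fun t : ℝ => p * t ^ (p - 1)) volume 0 b :=
      (intervalIntegral.intervalIntegrable_rpow' (by linarith)).const_mul p
    have h2 : ∫ t in (0 : ℝ)..b, p * t ^ (p - 1) = (b : ℝ) ^ p := by
      rw [intervalIntegral.integral_const_mul, integral_rpow (Or.inl (by linarith))]
      simp only [sub_add_cancel, Real.zero_rpow hp.ne', sub_zero]
      field_simp
    rw [intervalIntegral.integral_of_le b.coe_nonneg] at h2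
    rw [intervalIntegrable_iff_integrableOn_Ioc_of_le b.coe_nonneg] at hI
    calc (b : ℝ≥0∞) ^ p = ENNReal.ofReal ((b : ℝ) ^ p) := by
          rw [← ENNReal.ofReal_rpow_of_nonneg b.coe_nonneg hp.le, ENNReal.ofReal_coe_nnreal]
      _ = ∫⁻ t in Ioc 0 (b : ℝ), ENNReal.ofReal (p * t ^ (p - 1)) := by
          rw [← h2, ofReal_integral_eq_lintegral_ofReal hI]
          refine (ae_restrict_iff' measurableSet_Ioc).2 (ae_of_all _ fun t ht => ?_)
          have := ht.1
          simp only [Pi.zero_apply]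
          positivity
      _ = ∫⁻ t in Ioo 0 (b : ℝ), ENNReal.ofReal (p * t ^ (p - 1)) :=
          setLIntegral_congr Ioo_ae_eq_Ioc.symm
      _ = ∫⁻ t in Ioo 0 (b : ℝ), {t : ℝ | ENNReal.ofReal t < N}.indicator
            (fun t => ENNReal.ofReal (p * t ^ (p - 1))) t := by
          refine setLIntegral_congr_fun measurableSet_Ioo fun t ht => ?_
          have : ENNReal.ofReal t < N := by
            refine lt_of_lt_of_le ?_ hb
            rw [← ENNReal.ofReal_coe_nnreal]
            exact (ENNReal.ofReal_lt_ofReal_iff (ht.1.trans ht.2)).2 ht.2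
          simp [indicator, this]
      _ ≤ _ := lintegral_mono_set Ioo_subset_Ioi_self
  rcases eq_or_ne N ∞ with rfl | hN
  · rw [ENNReal.top_rpow_of_pos hp, top_le_iff]
    refine ENNReal.eq_top_of_forall_nnreal_le fun r => ?_
    have := key (r ^ (1 / p)) le_top
    rwa [← ENNReal.coe_rpow_of_nonneg _ hp.le, ← NNReal.rpow_mul, one_div_mul_cancel hp.ne',
      NNReal.rpow_one] at this
  · lift N to ℝ≥0 using hN
    exact key N le_rfl

lemma measurable_truncGauge {Φ : ℝ≥0 → ℝ≥0∞} (hmono : Monotone Φ) (c : ℝ≥0) :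
    Measurable fun z : ℝ≥0 × ℝ≥0 => truncGauge Φ c z.1 z.2 := by
  unfold truncGauge
  refine Measurable.ite (measurableSet_lt (by fun_prop) measurable_fst) ?_ measurable_const
  exact hmono.measurable.comp (measurable_fst.div measurable_snd)

/-- The sum of `‖h‖_{Φ,Q_i}^p |E_i|` over sets `E_i ⊆ Q_i` of bounded overlap is controlled by
`∫ h^p`. -/
lemma tsum_orliczNorm_rpow_mul_le [NeZero n] {Φ : ℝ≥0 → ℝ≥0∞} (hmono : Monotone Φ) {p : ℝ}
    (hp : 0 < p) {c : ℝ≥0} (hc0 : 0 < c) (hc : Φ c ≤ 2⁻¹) {h : (Fin n → ℝ) → ℝ≥0}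
    (hh : Measurable h) {ι : Type*} [Countable ι] (Q : ι → (Fin n → ℝ) × ℝ)
    (hQ : ∀ i, 0 < (Q i).2) (E : ι → Set (Fin n → ℝ)) (hE : ∀ i, MeasurableSet (E i))
    (hEQ : ∀ i, E i ⊆ cube (Q i).1 (Q i).2) (m : ℝ≥0∞)
    (hm : ∀ x, ∑' i, (E i).indicator (1 : (Fin n → ℝ) → ℝ≥0∞) x ≤ m) :
    ∑' i, orliczNorm Φ (cube (Q i).1 (Q i).2) h ^ p * volume (E i) ≤
      m * (5 ^ n * (2 * (ENNReal.ofReal p * tailInt Φ p c))) * ∫⁻ x, (h x : ℝ≥0∞) ^ p := by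
  set N : ι → ℝ≥0∞ := fun i => orliczNorm Φ (cube (Q i).1 (Q i).2) h with hN
  set w : ℝ → ℝ≥0∞ := fun t => ENNReal.ofReal (p * t ^ (p - 1)) with hw
  have hwm : Measurable w := by rw [hw]; fun_prop
  have hset : ∀ i, MeasurableSet {t : ℝ | ENNReal.ofReal t < N i} := fun i =>
    measurableSet_lt ENNReal.measurable_ofReal measurable_const
  -- At height `t`, the relevant `E i` lie in the union of the cubes with norm above `t`. Their
  -- overlap costs `m`, and Vitali against the truncated gauge bounds the volume of the union.
  have key : ∀ t : ℝ, 0 < t →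
      ∑' i, {t : ℝ | ENNReal.ofReal t < N i}.indicator (fun _ => volume (E i)) t ≤
        m * (5 ^ n * (2 * ∫⁻ x, truncGauge Φ c (h x) t.toNNReal)) := by
    intro t ht
    set S : Set ((Fin n → ℝ) × ℝ) := {d | ∃ i, Q i = d ∧ ENNReal.ofReal t < N i} with hS
    have hSc : S.Countable := (countable_range Q).mono (by rintro d ⟨i, rfl, _⟩; exact ⟨i, rfl⟩)
    have hmeas : MeasurableSet (⋃ d ∈ S, cube d.1 d.2) :=
      MeasurableSet.biUnion hSc fun d _ => measurableSet_cube _ _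
    have hvit : volume (⋃ d ∈ S, cube d.1 d.2) ≤
        5 ^ n * (2 * ∫⁻ x, truncGauge Φ c (h x) t.toNNReal) := by
      have := volume_biUnion_cube_le S (by rintro d ⟨i, rfl, _⟩; exact hQ i)
        ((2 : ℝ≥0∞) • volume.withDensity fun x => truncGauge Φ c (h x) t.toNNReal) (by
          rintro d ⟨i, rfl, hi⟩
          rw [Measure.smul_apply, withDensity_apply _ (measurableSet_cube _ _)]
          exact volume_cube_le_of_lt_orliczNorm hmono hc (Real.toNNReal_pos.2 ht) (hQ i) hi)
      rwa [Measure.smul_apply, withDensity_apply _ MeasurableSet.univ, setLIntegral_univ] at this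
    calc ∑' i, {t : ℝ | ENNReal.ofReal t < N i}.indicator (fun _ => volume (E i)) t
        = ∑' i, ∫⁻ x, {t : ℝ | ENNReal.ofReal t < N i}.indicator
            (fun _ => (E i).indicator (1 : (Fin n → ℝ) → ℝ≥0∞) x) t := by
          refine tsum_congr fun i => ?_
          by_cases hi : ENNReal.ofReal t < N i
          · simp [indicator_of_mem (s := {t : ℝ | ENNReal.ofReal t < N i}) (a := t) hi,
              lintegral_indicator_one (hE i)]
          · simp [indicator_of_notMem (s := {t : ℝ | ENNReal.ofReal t < N i}) (a := t) hi]
      _ = ∫⁻ x, ∑' i, {t : ℝ | ENNReal.ofReal t < N i}.indicator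
            (fun _ => (E i).indicator (1 : (Fin n → ℝ) → ℝ≥0∞) x) t := by
          refine (lintegral_tsum fun i => ?_).symm
          by_cases hi : ENNReal.ofReal t < N i
          · simp only [indicator_of_mem (s := {t : ℝ | ENNReal.ofReal t < N i}) (a := t) hi]
            exact (measurable_one.indicator (hE i)).aemeasurable
          · simp only [indicator_of_notMem (s := {t : ℝ | ENNReal.ofReal t < N i}) (a := t) hi]
            exact aemeasurable_const
      _ ≤ ∫⁻ x, (⋃ d ∈ S, cube d.1 d.2).indicator (fun _ => m) x := by
          refine lintegral_mono fun x => ?_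
          by_cases hx : x ∈ ⋃ d ∈ S, cube d.1 d.2
          · rw [indicator_of_mem hx]
            exact (ENNReal.tsum_le_tsum fun i => indicator_le_self _ _ _).trans (hm x)
          · rw [indicator_of_notMem hx, nonpos_iff_eq_zero, ENNReal.tsum_eq_zero]
            intro i
            by_cases hi : ENNReal.ofReal t < N i
            · rw [indicator_of_mem (s := {t : ℝ | ENNReal.ofReal t < N i}) (a := t) hi]
              refine indicator_of_notMem (fun hxE => hx ?_) _
              exact mem_biUnion (x := Q i) ⟨i, rfl, hi⟩ (hEQ i hxE)
            · exact indicator_of_notMem (s := {t : ℝ | ENNReal.ofReal t < N i}) (a := t) hi _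
      _ = m * volume (⋃ d ∈ S, cube d.1 d.2) := lintegral_indicator_const hmeas m
      _ ≤ _ := by gcongr
  have hmeas2 : Measurable fun z : ℝ × (Fin n → ℝ) => truncGauge Φ c (h z.2) z.1.toNNReal :=
    (measurable_truncGauge hmono c).comp
      ((hh.comp measurable_snd).prodMk (measurable_real_toNNReal.comp measurable_fst))
  have hin : ∀ t : ℝ, Measurable fun x => truncGauge Φ c (h x) t.toNNReal := fun t =>
    hmeas2.comp measurable_prodMk_left
  have hpow : Measurable fun t : ℝ => ENNReal.ofReal (t ^ (p - 1)) := by fun_prop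
  calc ∑' i, N i ^ p * volume (E i)
      ≤ ∑' i, ∫⁻ t in Ioi (0 : ℝ),
          w t * {t : ℝ | ENNReal.ofReal t < N i}.indicator (fun _ => volume (E i)) t := by
        refine ENNReal.tsum_le_tsum fun i => ?_
        refine (mul_le_mul_left (rpow_le_lintegral_layer hp (N i)) _).trans ?_
        rw [← lintegral_mul_const _ (hwm.indicator (hset i))]
        refine lintegral_mono fun t => ?_
        simp only [indicator]
        split_ifs <;> simp [hw]
    _ = ∫⁻ t in Ioi (0 : ℝ), w t *
          ∑' i, {t : ℝ | ENNReal.ofReal t < N i}.indicator (fun _ => volume (E i)) t := by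
        rw [← lintegral_tsum]
        · simp only [ENNReal.tsum_mul_left]
        · exact fun i => (hwm.mul (measurable_const.indicator (hset i))).aemeasurable
    _ ≤ ∫⁻ t in Ioi (0 : ℝ), w t *
          (m * (5 ^ n * (2 * ∫⁻ x, truncGauge Φ c (h x) t.toNNReal))) := by
        refine setLIntegral_mono' measurableSet_Ioi fun t ht => ?_
        exact mul_le_mul_right (key t ht) _
    _ = ∫⁻ t in Ioi (0 : ℝ), (m * (5 ^ n * (2 * ENNReal.ofReal p))) *
          ∫⁻ x, ENNReal.ofReal (t ^ (p - 1)) * truncGauge Φ c (h x) t.toNNReal := by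
        refine lintegral_congr fun t => ?_
        rw [lintegral_const_mul _ (hin t), hw]
        simp only [ENNReal.ofReal_mul hp.le]
        ring
    _ = (m * (5 ^ n * (2 * ENNReal.ofReal p))) * ∫⁻ t in Ioi (0 : ℝ),
          ∫⁻ x, ENNReal.ofReal (t ^ (p - 1)) * truncGauge Φ c (h x) t.toNNReal :=
        lintegral_const_mul _ (Measurable.lintegral_prod_right
          ((hpow.comp measurable_fst).mul hmeas2))
    _ = (m * (5 ^ n * (2 * ENNReal.ofReal p))) * ∫⁻ x, (h x : ℝ≥0∞) ^ p * tailInt Φ p c := by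
        rw [lintegral_lintegral_swap ((hpow.comp measurable_fst).mul hmeas2).aemeasurable]
        simp only [lintegral_truncGauge hp hc0]
    _ = _ := by
        rw [lintegral_mul_const _ (hh.coe_nnreal_ennreal.pow_const p)]
        ring

/-- The embedding for the single cube `Q` with `E = Q`: an infinite norm would make the left side
infinite. -/
lemma orliczNorm_lt_top [NeZero n] {Φ : ℝ≥0 → ℝ≥0∞} (hmono : Monotone Φ) {p : ℝ}
    (hp : 0 < p) {c : ℝ≥0} (hc0 : 0 < c) (hc : Φ c ≤ 2⁻¹) (htail : tailInt Φ p c < ∞)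
    {h : (Fin n → ℝ) → ℝ≥0} (hh : Measurable h) (hint : ∫⁻ x, (h x : ℝ≥0∞) ^ p < ∞)
    (a : Fin n → ℝ) {ℓ : ℝ} (hℓ : 0 < ℓ) : orliczNorm Φ (cube a ℓ) h < ∞ := by
  have := tsum_orliczNorm_rpow_mul_le hmono hp hc0 hc hh (fun _ : Unit => (a, ℓ)) (fun _ => hℓ)
    (fun _ => cube a ℓ) (fun _ => measurableSet_cube a ℓ) (fun _ => Subset.rfl) 1
    (fun x => by
      rw [tsum_fintype, Finset.univ_unique, Finset.sum_singleton]
      exact indicator_le_self' (fun _ _ => zero_le_one) x)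
  simp only [tsum_fintype, Finset.univ_unique, Finset.sum_const, Finset.card_singleton,
    one_smul] at this
  have hfin := this.trans_lt (ENNReal.mul_lt_top (ENNReal.mul_lt_top ENNReal.one_lt_top
    (ENNReal.mul_lt_top (by finiteness) (ENNReal.mul_lt_top (by finiteness)
    (ENNReal.mul_lt_top ENNReal.ofReal_lt_top htail)))) hint)
  by_contra htop
  rw [not_lt, top_le_iff] at htop
  rw [htop, ENNReal.top_rpow_of_pos hp, ENNReal.top_mul (volume_cube_pos a hℓ).ne'] at hfin
  exact lt_irrefl _ hfin

/-! ### Hölder's inequality and testing on one cube -/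

/-- Hölder's inequality for Luxemburg norms, the weight being averaged over the larger cube. -/
lemma laverage_mul_le {B : ℝ≥0 → ℝ≥0} (hB : Measurable B) {h s : (Fin n → ℝ) → ℝ≥0}
    (hs : AEMeasurable s) {c : (Fin n → ℝ) × ℝ} (hc : 0 < c.2)
    (hL : luxemburgNorm B (cube (quint c).1 (quint c).2) (fun x => (s x : ℝ)) ≠ ∞)
    (hN : orliczNorm (associate B) (cube c.1 c.2) h ≠ ∞) :
    ⨍⁻ x in cube c.1 c.2, (h x * s x : ℝ≥0∞) ∂volume ≤
      (5 ^ n + 1) * (luxemburgNorm B (cube (quint c).1 (quint c).2) (fun x => (s x : ℝ)) *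
        orliczNorm (associate B) (cube c.1 c.2) h) := by
  have hv0 := (volume_cube_pos c.1 hc).ne'
  have hvt := volume_cube_ne_top c.1 c.2
  have hR0 := (volume_cube_pos (quint c).1 (quint_pos hc)).ne'
  have hRt := volume_cube_ne_top (quint c).1 (quint c).2
  have hd0 : (5 ^ n + 1 : ℝ≥0∞) ≠ 0 := by simp
  have hdt : (5 ^ n + 1 : ℝ≥0∞) ≠ ∞ := by finiteness
  rw [mul_comm (5 ^ n + 1 : ℝ≥0∞), ← ENNReal.div_le_iff hd0 hdt]
  -- Both infima are approached from above by admissible `l` and `t`, which avoids attainment and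
  -- the case of a zero norm.
  refine ENNReal.le_mul_of_forall_lt (Or.inr hN) (Or.inl hL) fun l' hl' t' ht' => ?_
  simp only [luxemburgNorm, gt_iff_lt, iInf_lt_iff] at hl'
  simp only [orliczNorm, gt_iff_lt, iInf_lt_iff] at ht'
  obtain ⟨l, hl0, hl, hll⟩ := hl'
  obtain ⟨t, ht0, ht, htt⟩ := ht'
  refine le_trans ?_ (mul_le_mul' hll.le htt.le)
  rw [setLAverage_eq, ENNReal.div_le_iff hR0 hRt, one_mul] at hl
  rw [setLAverage_eq, ENNReal.div_le_iff hv0 hvt, one_mul] at ht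
  rw [ENNReal.div_le_iff hd0 hdt, setLAverage_eq, ENNReal.div_le_iff hv0 hvt]
  calc ∫⁻ x in cube c.1 c.2, (h x * s x : ℝ≥0∞)
      ≤ ∫⁻ x in cube c.1 c.2, (l * t : ℝ≥0∞) *
          ((B (‖(s x : ℝ)‖₊ / l) : ℝ≥0∞) + associate B (h x / t)) := by
        refine lintegral_mono fun x => ?_
        refine le_trans (le_of_eq ?_) (mul_le_mul_right (mul_le_add_associate B _ _) _)
        norm_cast
        rw [NNReal.nnnorm_eq]
        field_simp
    _ = (l * t : ℝ≥0∞) * ((∫⁻ x in cube c.1 c.2, (B (‖(s x : ℝ)‖₊ / l) : ℝ≥0∞)) +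
          ∫⁻ x in cube c.1 c.2, associate B (h x / t)) := by
        rw [lintegral_const_mul' _ _ (by finiteness), lintegral_add_left']
        have : AEMeasurable fun x => (B (‖(s x : ℝ)‖₊ / l) : ℝ≥0∞) := by
          refine (hB.comp_aemeasurable ?_).coe_nnreal_ennreal
          simp only [NNReal.nnnorm_eq]
          exact hs.div_const l
        exact this.restrict
    -- The `5^n` is the price of normalizing `B(s/l)` over the enlarged cube; the other summand
    -- comes from `h`.
    _ ≤ (l * t : ℝ≥0∞) * (5 ^ n * volume (cube c.1 c.2) + volume (cube c.1 c.2)) := by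
        gcongr
        · rw [← volume_quint]
          exact (lintegral_mono_set (cube_subset_quint hc)).trans hl
    _ = _ := by ring

/-- The testing estimate on a single cube. -/
lemma fracAvg_rpow_mul_le [NeZero n] {B : ℝ≥0 → ℝ≥0} (hB : Measurable B) {α p q : ℝ} (hα : 0 ≤ α)
    (hp : 0 < p) (hq : 0 < q) {h s u : (Fin n → ℝ) → ℝ≥0} (hs : AEMeasurable s)
    {K : ℝ≥0∞} (hKt : K ≠ ∞) {c : (Fin n → ℝ) × ℝ} (hc : 0 < c.2)
    (hK : volume (cube (quint c).1 (quint c).2) ^ (α / n + 1 / q - 1 / p) *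
      (⨍⁻ x in cube (quint c).1 (quint c).2, (u x : ℝ≥0∞) ∂volume) ^ (1 / q) *
      luxemburgNorm B (cube (quint c).1 (quint c).2) (fun x => (s x : ℝ)) ≤ K)
    (hN : orliczNorm (associate B) (cube c.1 c.2) h ≠ ∞) :
    fracAvg α (fun x => (h x * s x : ℝ≥0∞)) c ^ q *
        ∫⁻ x in cube (quint c).1 (quint c).2, (u x : ℝ≥0∞) ≤
      ((5 ^ n + 1) * K * (5 ^ n) ^ (1 / p)) ^ q *
        (orliczNorm (associate B) (cube c.1 c.2) h ^ p * volume (cube c.1 c.2)) ^ (q / p) := by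
  set R := cube (quint c).1 (quint c).2 with hR
  have hV0 : volume R ≠ 0 := (volume_cube_pos (quint c).1 (quint_pos hc)).ne'
  have hVt : volume R ≠ ∞ := volume_cube_ne_top (quint c).1 (quint c).2
  -- Only when `u` vanishes on `R` can the convention `0 * ∞ = 0` hide an infinite norm of `s`; then
  -- the left side is zero anyway.
  by_cases hu : ∫⁻ x in R, (u x : ℝ≥0∞) = 0
  · simp [hu]
  have hua : ⨍⁻ x in R, (u x : ℝ≥0∞) ∂volume ≠ 0 := by
    rw [setLAverage_eq]
    exact (ENNReal.div_pos hu hVt).ne'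
  have huint : ∫⁻ x in R, (u x : ℝ≥0∞) = (⨍⁻ x in R, (u x : ℝ≥0∞) ∂volume) * volume R := by
    rw [setLAverage_eq, ENNReal.div_mul_cancel hV0 hVt]
  set U := ⨍⁻ x in R, (u x : ℝ≥0∞) ∂volume with hU
  set N := orliczNorm (associate B) (cube c.1 c.2) h with hN'
  have hU0 : U ^ (1 / q) ≠ 0 := by
    simp [ENNReal.rpow_eq_zero_iff, hua, hq, not_lt.2 hq.le]
  have hL : luxemburgNorm B R (fun x => (s x : ℝ)) ≠ ∞ := by
    intro htop
    rw [htop, ENNReal.mul_top, top_le_iff] at hK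
    · exact hKt hK
    · exact mul_ne_zero (ENNReal.rpow_pos (pos_iff_ne_zero.2 hV0) hVt).ne' hU0
  set L := luxemburgNorm B R (fun x => (s x : ℝ)) with hL'
  have hX : fracAvg α (fun x => (h x * s x : ℝ≥0∞)) c * (U * volume R) ^ (1 / q) ≤
      ((5 ^ n + 1) * K * (5 ^ n) ^ (1 / p)) * (N * volume (cube c.1 c.2) ^ (1 / p)) := by
    calc fracAvg α (fun x => (h x * s x : ℝ≥0∞)) c * (U * volume R) ^ (1 / q)
        ≤ (volume R ^ (α / n) * ((5 ^ n + 1) * (L * N))) * (U * volume R) ^ (1 / q) := by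
          rw [fracAvg]
          gcongr
          · exact cube_subset_quint hc
          · exact laverage_mul_le hB hs hc hL hN
      _ = (5 ^ n + 1) * ((volume R ^ (α / n) * volume R ^ (1 / q)) * U ^ (1 / q) * L) * N := by
          rw [ENNReal.mul_rpow_of_nonneg _ _ (by positivity)]
          ring
      _ = (5 ^ n + 1) * (volume R ^ (α / n + 1 / q - 1 / p) * U ^ (1 / q) * L) *
            (N * volume R ^ (1 / p)) := by
          have : volume R ^ (α / n) * volume R ^ (1 / q) =
              volume R ^ (α / n + 1 / q - 1 / p) * volume R ^ (1 / p) := by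
            rw [← ENNReal.rpow_add _ _ hV0 hVt, ← ENNReal.rpow_add _ _ hV0 hVt]
            congr 1
            ring
          rw [this]
          ring
      _ ≤ (5 ^ n + 1) * K * (N * volume R ^ (1 / p)) := by gcongr
      _ = _ := by
          rw [hR, volume_quint, ENNReal.mul_rpow_of_nonneg _ _ (by positivity)]
          ring
  have hXq := ENNReal.rpow_le_rpow hX hq.le
  rw [ENNReal.mul_rpow_of_nonneg _ _ hq.le, ← ENNReal.rpow_mul, one_div_mul_cancel hq.ne',
    ENNReal.rpow_one, ← huint, ENNReal.mul_rpow_of_nonneg _ _ hq.le] at hXq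
  refine hXq.trans (le_of_eq ?_)
  congr 1
  rw [ENNReal.mul_rpow_of_nonneg _ _ hq.le, ENNReal.mul_rpow_of_nonneg _ _ (by positivity),
    ← ENNReal.rpow_mul, ← ENNReal.rpow_mul]
  congr 2 <;> field_simp

/-! ### Local and global weak-type estimates -/

/-- Superlevel sets of the maximal function fill at most half of a cube that meets a much lower
sublevel set. -/
lemma two_mul_volume_inter_superlevel_le [NeZero n] {α : ℝ} (hα : 0 ≤ α)
    (G : (Fin n → ℝ) → ℝ≥0∞)
    {T : ℝ≥0∞} (hT0 : T ≠ 0) (hTt : T ≠ ∞) {c : (Fin n → ℝ) × ℝ} (hc : 0 < c.2)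
    {y : Fin n → ℝ} (hy : y ∈ cube c.1 c.2) (hyT : maxFun α G y ≤ T) :
    2 * volume (cube c.1 c.2 ∩ {x | 2 * 25 ^ n * T < maxFun α G x}) ≤ volume (cube c.1 c.2) := by
  set S : Set ((Fin n → ℝ) × ℝ) := {d | 0 < d.2 ∧ (cube d.1 d.2 ∩ cube c.1 c.2).Nonempty ∧
    2 * 25 ^ n * T < fracAvg α G d} with hS
  set R := cube (quint c).1 (quint c).2 with hR
  have hV0 : volume R ≠ 0 := (volume_cube_pos (quint c).1 (quint_pos hc)).ne'
  have hVt : volume R ≠ ∞ := volume_cube_ne_top (quint c).1 (quint c).2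
  have haT0 : 2 * 25 ^ n * T ≠ 0 := by simp [hT0]
  have haTt : 2 * 25 ^ n * T ≠ ∞ := by finiteness
  have hsub : ∀ d ∈ S, cube d.1 d.2 ⊆ R := by
    rintro d ⟨hd0, hne, hlt⟩
    -- Small cubes stay inside `R`. A large one has an enlargement containing `y`, which forces its
    -- own average down to at most `5^n T`, below the threshold.
    rcases le_total d.2 (2 * c.2) with hle | hle
    · exact cube_subset_quint_of_inter hne hle
    · exfalso
      have hyd : y ∈ cube (quint d).1 (quint d).2 :=
        cube_subset_quint_of_inter (by rwa [inter_comm]) (by linarith) hy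
      have h1 := (fracAvg_le_maxFun (α := α) (G := G) (quint_pos hd0) hyd).trans hyT
      have h2 : fracAvg α G d ≤ 5 ^ n * fracAvg α G (quint d) := by
        rw [fracAvg_eq, fracAvg_eq]
        calc volume (cube d.1 d.2) ^ (α / n) * (volume (cube d.1 d.2))⁻¹ *
              ∫⁻ y in cube d.1 d.2, G y
            ≤ volume (cube (quint d).1 (quint d).2) ^ (α / n) * (volume (cube d.1 d.2))⁻¹ *
              ∫⁻ y in cube (quint d).1 (quint d).2, G y := by
              have := cube_subset_quint hd0
              gcongr
          _ = volume (cube (quint d).1 (quint d).2) ^ (α / n) *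
              (5 ^ n * (volume (cube (quint d).1 (quint d).2))⁻¹) *
              ∫⁻ y in cube (quint d).1 (quint d).2, G y := by
              congr 2
              rw [volume_quint, ENNReal.mul_inv (by simp) (by simp), ← mul_assoc,
                ENNReal.mul_inv_cancel (by simp) (by finiteness), one_mul]
          _ = _ := by ring
      refine absurd (hlt.trans_le (h2.trans (mul_le_mul_right h1 _))) (not_lt.2 ?_)
      gcongr
      calc (5 : ℝ≥0∞) ^ n ≤ 1 * 25 ^ n := by rw [one_mul]; gcongr; norm_num
        _ ≤ _ := by gcongr; norm_num
  have hvit := volume_biUnion_cube_le S (fun d hd => hd.1)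
    (((2 * 25 ^ n * T)⁻¹ * volume R ^ (α / n)) • (volume.restrict R).withDensity G) (by
      intro d hd
      have hdm := measurableSet_cube d.1 d.2
      have hd0 := (volume_cube_pos d.1 hd.1).ne'
      have hdt := volume_cube_ne_top d.1 d.2
      rw [Measure.smul_apply, withDensity_apply _ hdm, Measure.restrict_restrict hdm,
        inter_eq_left.2 (hsub d hd), smul_eq_mul, mul_assoc, ← ENNReal.div_eq_inv_mul,
        ENNReal.le_div_iff_mul_le (Or.inl haT0) (Or.inl haTt)]
      have h1 := hd.2.2.le
      rw [fracAvg, setLAverage_eq, ← mul_div_assoc,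
        ENNReal.le_div_iff_mul_le (Or.inl hd0) (Or.inl hdt)] at h1
      rw [mul_comm]
      refine h1.trans ?_
      gcongr
      exact hsub d hd)
  rw [Measure.smul_apply, withDensity_apply _ MeasurableSet.univ, Measure.restrict_univ,
    smul_eq_mul, mul_assoc] at hvit
  -- `R` also contains `y`, so its average is at most `T`. This `5^n`, the Vitali `5^n` and the `2`
  -- to be gained make up `2 * 25^n`.
  have hA : volume R ^ (α / n) * ∫⁻ x in R, G x ≤ T * (5 ^ n * volume (cube c.1 c.2)) := by
    have h1 := (fracAvg_le_maxFun (α := α) (G := G) (quint_pos hc) (cube_subset_quint hc hy)).trans hyT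
    rw [fracAvg, setLAverage_eq, ← mul_div_assoc, ENNReal.div_le_iff hV0 hVt] at h1
    rwa [← volume_quint c]
  calc 2 * volume (cube c.1 c.2 ∩ {x | 2 * 25 ^ n * T < maxFun α G x})
      ≤ 2 * volume (⋃ d ∈ S, cube d.1 d.2) := by
        gcongr
        rintro x ⟨hxc, hx⟩
        obtain ⟨d, hd, hxd, hlt⟩ := lt_maxFun_iff.1 hx
        exact mem_biUnion (x := d) ⟨hd, ⟨x, hxd, hxc⟩, hlt⟩ hxd
    _ ≤ 2 * (5 ^ n * ((2 * 25 ^ n * T)⁻¹ * (T * (5 ^ n * volume (cube c.1 c.2))))) := by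
        refine mul_le_mul_right (hvit.trans ?_) _
        gcongr
    _ = (2 * 25 ^ n * T)⁻¹ * (2 * 25 ^ n * T) * volume (cube c.1 c.2) := by
        have : (25 : ℝ≥0∞) ^ n = 5 ^ n * 5 ^ n := by rw [← mul_pow]; norm_num
        rw [this]
        ring
    _ = _ := by rw [ENNReal.inv_mul_cancel haT0 haTt, one_mul]

/-- The average is at most `|Q|^{α/n-1} ∫ G`, whose exponent is negative; hence cubes selected at a
fixed level have bounded size. -/
lemma volume_cube_le_of_lt_fracAvg [NeZero n] {α : ℝ} (hα : α < n) {G : (Fin n → ℝ) → ℝ≥0∞}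
    {T : ℝ≥0∞} (hT0 : T ≠ 0) {c : (Fin n → ℝ) × ℝ} (hc : 0 < c.2) (h : T < fracAvg α G c) :
    volume (cube c.1 c.2) ≤ ((∫⁻ x, G x) / T) ^ (1 - α / n)⁻¹ := by
  have hv0 := (volume_cube_pos c.1 hc).ne'
  have hvt := volume_cube_ne_top c.1 c.2
  have hn : (0 : ℝ) < n := Nat.cast_pos.2 (NeZero.pos n)
  have hβ : 0 < 1 - α / n := by
    rw [sub_pos, div_lt_one hn]; exact hα
  rw [ENNReal.le_rpow_inv_iff hβ, ENNReal.le_div_iff_mul_le (Or.inl hT0) (Or.inl h.ne_top),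
    ENNReal.rpow_sub _ _ hv0 hvt, ENNReal.rpow_one]
  have hr0 := (ENNReal.rpow_pos (pos_iff_ne_zero.2 hv0) hvt (p := α / n)).ne'
  have hrt := ENNReal.rpow_ne_top_of_ne_zero hv0 hvt (y := α / n)
  rw [fracAvg, setLAverage_eq, ← mul_div_assoc] at h
  have h1 := h.le
  rw [ENNReal.le_div_iff_mul_le (Or.inl hv0) (Or.inl hvt)] at h1
  rw [← ENNReal.mul_div_right_comm, ENNReal.div_le_iff hr0 hrt, mul_comm _ T, mul_comm _ (_ ^ _)]
  refine h1.trans ?_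
  gcongr
  exact Measure.restrict_le_self

/-- At levels `t ≥ 1` all competing cubes have volume at most `V`, so Vitali gives a weak-type bound
`C/t`; let `t → ∞`. -/
lemma ae_maxFun_ne_top [NeZero n] {α : ℝ} (hα0 : 0 ≤ α) (hα : α < n) {G : (Fin n → ℝ) → ℝ≥0∞}
    (hG : ∫⁻ x, G x ≠ ∞) : ∀ᵐ x, maxFun α G x ≠ ∞ := by
  have hn : (0 : ℝ) < n := Nat.cast_pos.2 (NeZero.pos n)
  have hβ : 0 < 1 - α / n := by
    rw [sub_pos, div_lt_one hn]; exact hα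
  set V := (∫⁻ x, G x) ^ (1 - α / n)⁻¹ with hV
  have hVt : V ≠ ∞ := ENNReal.rpow_ne_top_of_nonneg (inv_nonneg.2 hβ.le) hG
  have hVr : V ^ (α / n) ≠ ∞ := ENNReal.rpow_ne_top_of_nonneg (by positivity) hVt
  have key : ∀ t : ℝ≥0, 1 ≤ t →
      volume {x | maxFun α G x = ∞} * t ≤ 5 ^ n * (V ^ (α / n) * ∫⁻ x, G x) := by
    intro t ht
    have ht0 : (t : ℝ≥0∞) ≠ 0 := by
      simpa using (zero_lt_one.trans_le ht).ne'
    have ht1 : (1 : ℝ≥0∞) ≤ t := by exact_mod_cast ht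
    set S : Set ((Fin n → ℝ) × ℝ) := {d | 0 < d.2 ∧ (t : ℝ≥0∞) < fracAvg α G d} with hS
    have hvit := volume_biUnion_cube_le S (fun d hd => hd.1)
      (((t : ℝ≥0∞)⁻¹ * V ^ (α / n)) • volume.withDensity G) (by
        intro d hd
        have hdm := measurableSet_cube d.1 d.2
        have hd0 := (volume_cube_pos d.1 hd.1).ne'
        have hdt := volume_cube_ne_top d.1 d.2
        rw [Measure.smul_apply, withDensity_apply _ hdm, smul_eq_mul, mul_assoc,
          ← ENNReal.div_eq_inv_mul, ENNReal.le_div_iff_mul_le (Or.inl ht0)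
          (Or.inl ENNReal.coe_ne_top)]
        have h1 := hd.2.le
        rw [fracAvg, setLAverage_eq, ← mul_div_assoc,
          ENNReal.le_div_iff_mul_le (Or.inl hd0) (Or.inl hdt)] at h1
        rw [mul_comm]
        refine h1.trans ?_
        gcongr
        refine (volume_cube_le_of_lt_fracAvg hα ht0 hd.1 hd.2).trans ?_
        refine ENNReal.rpow_le_rpow ?_ (inv_nonneg.2 hβ.le)
        exact ENNReal.div_le_of_le_mul (le_mul_of_one_le_right' ht1))
    rw [Measure.smul_apply, withDensity_apply _ MeasurableSet.univ, setLIntegral_univ,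
      smul_eq_mul, mul_assoc, ← ENNReal.div_eq_inv_mul, ← mul_div_assoc,
      ENNReal.le_div_iff_mul_le (Or.inl ht0) (Or.inl ENNReal.coe_ne_top)] at hvit
    refine le_trans ?_ hvit
    gcongr
    intro x (hx : maxFun α G x = ∞)
    obtain ⟨d, hd, hxd, hlt⟩ := lt_maxFun_iff.1 (hx ▸ ENNReal.coe_lt_top : (t : ℝ≥0∞) < _)
    exact mem_biUnion (x := d) ⟨hd, hlt⟩ hxd
  have hCt : 5 ^ n * (V ^ (α / n) * ∫⁻ x, G x) ≠ ∞ := by finiteness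
  rw [ae_iff]
  simp only [not_not]
  by_contra hne
  lift 5 ^ n * (V ^ (α / n) * ∫⁻ x, G x) to ℝ≥0 using hCt with C
  generalize volume {x | maxFun α G x = ∞} = v at hne key
  have hlim : ∞ ≤ (C : ℝ≥0∞) := by
    rw [← ENNReal.mul_top hne, ← ENNReal.iSup_natCast, ENNReal.mul_iSup]
    refine iSup_le fun k => ?_
    refine le_trans ?_ (key (k + 1) le_add_self)
    rw [ENNReal.coe_add, ENNReal.coe_natCast]
    exact mul_le_mul_right (le_self_add (a := (k : ℝ≥0∞))) _
  exact absurd hlim (by simp)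

/-! ### Level-by-level selection of cubes -/

/-- Write `x^r = x * x^(r-1)` and bound the second factor by the full sum. It is applied with `r =
q/p`. -/
lemma tsum_rpow_le_rpow_tsum {ι : Type*} (x : ι → ℝ≥0∞) {r : ℝ} (hr : 1 ≤ r) :
    ∑' i, x i ^ r ≤ (∑' i, x i) ^ r := by
  have h : ∀ y : ℝ≥0∞, y ^ r = y * y ^ (r - 1) := fun y => by
    conv_rhs => rw [← ENNReal.rpow_one y, ← ENNReal.rpow_mul, one_mul,
      ← ENNReal.rpow_add_of_nonneg _ _ zero_le_one (by linarith)]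
    congr 1
    ring
  calc ∑' i, x i ^ r = ∑' i, x i * x i ^ (r - 1) := tsum_congr fun i => h _
    _ ≤ ∑' i, x i * (∑' j, x j) ^ (r - 1) := by
        refine ENNReal.tsum_le_tsum fun i => ?_
        exact mul_le_mul_right (ENNReal.rpow_le_rpow (ENNReal.le_tsum i) (by linarith)) _
    _ = _ := by rw [ENNReal.tsum_mul_right, ← h]

lemma tsum_indicator_le_of_pairwise_disjoint {ι X : Type*} {E : ι → Set X} {A : Set X}
    (hE : Pairwise (Function.onFun Disjoint E)) (hA : ∀ i, E i ⊆ A) (x : X) :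
    ∑' i, (E i).indicator (1 : X → ℝ≥0∞) x ≤ A.indicator 1 x := by
  by_cases h : ∃ i, x ∈ E i
  · obtain ⟨i, hi⟩ := h
    rw [tsum_eq_single i fun j hj => indicator_of_notMem
      (fun hxj => (Set.disjoint_left.1 (hE hj) hxj) hi) _]
    exact indicator_le_indicator_of_subset (hA i) (fun _ => zero_le_one) x
  · push Not at h
    simp [indicator_of_notMem (h _)]

/-- From a testing estimate on cubes and a Carleson-type embedding to the bound for the maximal
function. -/
theorem lintegral_maxFun_rpow_mul_le [NeZero n] {α : ℝ} (hα0 : 0 ≤ α) (hα : α < n)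
    {G : (Fin n → ℝ) → ℝ≥0∞} (hG : ∫⁻ x, G x ≠ ∞) {q r : ℝ} (hq : 0 < q) (hr : 1 ≤ r)
    {u : (Fin n → ℝ) → ℝ≥0} (hu : AEMeasurable u) (W : (Fin n → ℝ) × ℝ → ℝ≥0∞) {D H : ℝ≥0∞}
    (hW : ∀ c : (Fin n → ℝ) × ℝ, 0 < c.2 → fracAvg α G c ^ q *
      ∫⁻ x in cube (quint c).1 (quint c).2, (u x : ℝ≥0∞) ≤ D * (W c * volume (cube c.1 c.2)) ^ r)
    (hH : ∀ (ι : Type) [Countable ι] (Q : ι → (Fin n → ℝ) × ℝ), (∀ i, 0 < (Q i).2) →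
      ∀ E : ι → Set (Fin n → ℝ), (∀ i, MeasurableSet (E i)) →
      (∀ i, E i ⊆ cube (Q i).1 (Q i).2) →
      (∀ x, ∑' i, (E i).indicator (1 : (Fin n → ℝ) → ℝ≥0∞) x ≤ 2) →
      ∑' i, W (Q i) * volume (E i) ≤ H) :
    ∫⁻ x, maxFun α G x ^ q * u x ≤ (2 * 25 ^ n) ^ q * (D * (2 * H) ^ r) := by
  set a : ℝ≥0∞ := 2 * 25 ^ n with ha
  have ha1 : 1 < a := by
    calc (1 : ℝ≥0∞) < 2 * 1 := by norm_num
      _ ≤ _ := mul_le_mul_right (one_le_pow₀ (by norm_num)) _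
  have hat : a ≠ ∞ := by finiteness
  have ha0 : a ≠ 0 := (zero_lt_one.trans ha1).ne'
  have hak0 : ∀ k : ℤ, a ^ k ≠ 0 := fun k => (ENNReal.zpow_pos ha0 hat k).ne'
  have hakt : ∀ k : ℤ, a ^ k ≠ ∞ := fun k => (ENNReal.zpow_lt_top ha0 hat k).ne
  have hmono : ∀ {j k : ℤ}, j ≤ k → a ^ j ≤ a ^ k := fun h => ENNReal.zpow_le_of_le ha1.le h
  have hsucc : ∀ k : ℤ, a ^ (k + 1) = a * a ^ k := fun k => by
    rw [ENNReal.zpow_add ha0 hat, zpow_one, mul_comm]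
  set F := maxFun α G with hF
  have hFm : Measurable F := measurable_maxFun α G
  set Ω : ℤ → Set (Fin n → ℝ) := fun k => {x | a ^ k < F x} with hΩ
  have hΩm : ∀ k, MeasurableSet (Ω k) := fun k => measurableSet_lt measurable_const hFm
  -- The point `y` of low maximal function is what later makes the selected cubes sparse.
  set S : ℤ → Set ((Fin n → ℝ) × ℝ) := fun k =>
    {c | 0 < c.2 ∧ a ^ k < fracAvg α G c ∧ ∃ y ∈ cube c.1 c.2, F y ≤ a ^ (k + 1)} with hS
  have hbound : ∀ k, ∃ R : ℝ, ∀ c ∈ S k, c.2 ≤ R := fun k => by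
    have hn : (0 : ℝ) < n := Nat.cast_pos.2 (NeZero.pos n)
    have hβ : 0 < 1 - α / n := by rw [sub_pos, div_lt_one hn]; exact hα
    exact exists_side_bound (ENNReal.rpow_ne_top_of_nonneg (inv_nonneg.2 hβ.le)
      (ENNReal.div_ne_top hG (hak0 k)))
      fun c hc => volume_cube_le_of_lt_fracAvg hα (hak0 k) hc.1 hc.2.1
  choose R hR using hbound
  choose U hUS hUc hUd hUcov using fun k =>
    exists_disjoint_subfamily (S k) (fun c hc => hc.1) (R k) (hR k)
  have hUcount : ∀ k, Countable (U k) := fun k => (hUc k).to_subtype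
  set Dl : ℤ → Set (Fin n → ℝ) := fun k => Ω k \ Ω (k + 1) with hDl
  have hDdisj : Pairwise (Function.onFun Disjoint Dl) := by
    have hlt : ∀ j k : ℤ, j < k → Disjoint (Dl j) (Dl k) := fun j k hjk =>
      Set.disjoint_left.2 fun x hxj hxk =>
        hxj.2 ((hmono (by omega : j + 1 ≤ k)).trans_lt hxk.1)
    intro j k hjk
    rcases lt_or_gt_of_ne hjk with h | h
    · exact hlt j k h
    · exact (hlt k j h).symm
  have hDcov : ∀ k, Dl k ⊆ ⋃ c : U k, cube (quint c.1).1 (quint c.1).2 := by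
    rintro k x ⟨hx, hx'⟩
    obtain ⟨c, hc, hxc, hlt⟩ := lt_maxFun_iff.1 hx
    obtain ⟨b, hb, hsub⟩ := hUcov k c ⟨hc, hlt, x, hxc, not_lt.1 hx'⟩
    exact mem_iUnion.2 ⟨⟨b, hb⟩, hsub hxc⟩
  set Q : (Σ k, U k) → (Fin n → ℝ) × ℝ := fun i => i.2.1 with hQ
  set E : (Σ k, U k) → Set (Fin n → ℝ) := fun i =>
    cube (Q i).1 (Q i).2 \ Ω (i.1 + 2) with hE
  have hQpos : ∀ i, 0 < (Q i).2 := fun i => (hUS i.1 i.2.2).1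
  have hEm : ∀ i, MeasurableSet (E i) := fun i => (measurableSet_cube _ _).diff (hΩm _)
  have hoverlap : ∀ x, ∑' i, (E i).indicator (1 : (Fin n → ℝ) → ℝ≥0∞) x ≤ 2 := by
    intro x
    have hsum : ∑' k, (Dl k).indicator (1 : (Fin n → ℝ) → ℝ≥0∞) x ≤ 1 :=
      (tsum_indicator_le_of_pairwise_disjoint hDdisj (fun _ => subset_univ _) x).trans (by simp)
    calc ∑' i, (E i).indicator (1 : (Fin n → ℝ) → ℝ≥0∞) x
        = ∑' k, ∑' c : U k, (E ⟨k, c⟩).indicator (1 : (Fin n → ℝ) → ℝ≥0∞) x :=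
          ENNReal.tsum_sigma' _
      _ ≤ ∑' k, (Ω k \ Ω (k + 2)).indicator (1 : (Fin n → ℝ) → ℝ≥0∞) x := by
          refine ENNReal.tsum_le_tsum fun k => tsum_indicator_le_of_pairwise_disjoint
            (fun c d hcd => ?_) (fun c => ?_) x
          · exact (hUd k c.2 d.2 fun h => hcd (Subtype.ext h)).mono sdiff_subset sdiff_subset
          · refine sdiff_subset_sdiff_left fun y hy => ?_
            exact lt_maxFun_iff.2 ⟨c.1, (hUS k c.2).1, hy, (hUS k c.2).2.1⟩
      -- Removing `Ω (k + 2)` leaves two consecutive layers, whence overlap two.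
      _ ≤ ∑' k, ((Dl k).indicator (1 : (Fin n → ℝ) → ℝ≥0∞) x + (Dl (k + 1)).indicator 1 x) := by
          refine ENNReal.tsum_le_tsum fun k => ?_
          by_cases hx : x ∈ Ω k \ Ω (k + 2)
          · by_cases hx1 : x ∈ Ω (k + 1)
            · have : x ∈ Dl (k + 1) := ⟨hx1, by rw [add_assoc]; exact hx.2⟩
              rw [indicator_of_mem hx, indicator_of_mem this]
              exact le_add_self
            · have : x ∈ Dl k := ⟨hx.1, hx1⟩
              rw [indicator_of_mem hx, indicator_of_mem this]
              exact le_self_add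
          · rw [indicator_of_notMem hx]
            exact zero_le
      _ ≤ 1 + 1 := by
          rw [ENNReal.tsum_add]
          refine add_le_add hsum ?_
          exact ((Equiv.addRight (1 : ℤ)).tsum_eq
            (fun k => (Dl k).indicator (1 : (Fin n → ℝ) → ℝ≥0∞) x)).trans_le hsum
      _ = 2 := one_add_one_eq_two
  have hsparse : ∀ i, volume (cube (Q i).1 (Q i).2) ≤ 2 * volume (E i) := by
    intro i
    obtain ⟨y, hy, hyF⟩ := (hUS i.1 i.2.2).2.2
    have h1 := two_mul_volume_inter_superlevel_le hα0 G (hak0 _) (hakt _) (hQpos i) hy hyF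
    have hset : {x | 2 * 25 ^ n * a ^ (i.1 + 1) < maxFun α G x} = Ω (i.1 + 2) := by
      have : a ^ (i.1 + 2) = a * a ^ (i.1 + 1) := by
        rw [← hsucc, add_assoc]
        rfl
      simp only [hΩ, this]
      rfl
    rw [hset] at h1
    have h2 := measure_inter_add_sdiff (μ := volume) (cube (Q i).1 (Q i).2) (hΩm (i.1 + 2))
    have hvt := volume_cube_ne_top (Q i).1 (Q i).2
    -- Adding `|Q|` to both sides avoids subtraction: `2|Q| = 2|Q ∩ Ω| + 2|E|`, with first term at
    -- most `|Q|`.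
    refine ENNReal.le_of_add_le_add_left hvt ?_
    calc volume (cube (Q i).1 (Q i).2) + volume (cube (Q i).1 (Q i).2)
        = 2 * volume (cube (Q i).1 (Q i).2 ∩ Ω (i.1 + 2)) + 2 * volume (E i) := by
          rw [← mul_add, h2, two_mul]
      _ ≤ _ := by gcongr
  calc ∫⁻ x, F x ^ q * u x
      ≤ ∫⁻ x, ∑' k : ℤ, (Dl k).indicator (fun x => (a ^ (k + 1)) ^ q * (u x : ℝ≥0∞)) x := by
        refine lintegral_mono_ae ?_
        -- Points with `F x = ∞` lie in no layer, so they must form a null set.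
        filter_upwards [ae_maxFun_ne_top hα0 hα hG] with x hx
        rcases eq_or_ne (F x) 0 with h0 | h0
        · simp [h0, ENNReal.zero_rpow_of_pos hq]
        · obtain ⟨k, hk⟩ := ENNReal.exists_mem_Ioc_zpow h0 hx ha1 hat
          refine le_trans ?_ (ENNReal.le_tsum k)
          have hxD : x ∈ Dl k := ⟨hk.1, not_lt.2 hk.2⟩
          rw [indicator_of_mem hxD]
          gcongr
          exact hk.2
    _ = ∑' k : ℤ, ∫⁻ x in Dl k, (a ^ (k + 1)) ^ q * (u x : ℝ≥0∞) := by
        rw [lintegral_tsum]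
        · exact tsum_congr fun k => lintegral_indicator ((hΩm k).diff (hΩm _)) _
        · exact fun k => (hu.coe_nnreal_ennreal.const_mul _).indicator ((hΩm k).diff (hΩm _))
    _ ≤ ∑' k : ℤ, ∑' c : U k, a ^ q * (D * (W c.1 * volume (cube c.1.1 c.1.2)) ^ r) := by
        refine ENNReal.tsum_le_tsum fun k => ?_
        rw [lintegral_const_mul' _ _ (ENNReal.rpow_ne_top_of_nonneg hq.le (hakt _))]
        calc (a ^ (k + 1)) ^ q * ∫⁻ x in Dl k, (u x : ℝ≥0∞)
            ≤ (a ^ (k + 1)) ^ q * ∑' c : U k,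
                ∫⁻ x in cube (quint c.1).1 (quint c.1).2, (u x : ℝ≥0∞) := by
              gcongr
              exact (lintegral_mono_set (hDcov k)).trans (lintegral_iUnion_le _ _)
          _ = ∑' c : U k, a ^ q * ((a ^ k) ^ q *
                ∫⁻ x in cube (quint c.1).1 (quint c.1).2, (u x : ℝ≥0∞)) := by
              rw [← ENNReal.tsum_mul_left]
              refine tsum_congr fun c => ?_
              rw [hsucc, ENNReal.mul_rpow_of_nonneg _ _ hq.le, mul_assoc]
          _ ≤ _ := by
              refine ENNReal.tsum_le_tsum fun c => mul_le_mul_right ?_ _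
              refine le_trans ?_ (hW c.1 (hUS k c.2).1)
              gcongr
              exact (hUS k c.2).2.1.le
    _ = a ^ q * (D * ∑' i : Σ k, U k, (W (Q i) * volume (cube (Q i).1 (Q i).2)) ^ r) := by
        simp only [ENNReal.tsum_mul_left]
        rw [ENNReal.tsum_sigma']
    _ ≤ a ^ q * (D * (∑' i : Σ k, U k, W (Q i) * volume (cube (Q i).1 (Q i).2)) ^ r) := by
        gcongr
        exact tsum_rpow_le_rpow_tsum _ hr
    _ ≤ a ^ q * (D * (2 * ∑' i : Σ k, U k, W (Q i) * volume (E i)) ^ r) := by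
        gcongr
        rw [← ENNReal.tsum_mul_left]
        refine ENNReal.tsum_le_tsum fun i => ?_
        calc W (Q i) * volume (cube (Q i).1 (Q i).2) ≤ W (Q i) * (2 * volume (E i)) :=
              mul_le_mul_right (hsparse i) _
          _ = _ := by ring
    _ ≤ _ := by
        gcongr
        exact hH _ Q hQpos E hEm (fun i => sdiff_subset) hoverlap

/-! ### Exhaustion by large cubes -/

lemma fracAvg_congr_ae (α : ℝ) {G G' : (Fin n → ℝ) → ℝ≥0∞} {c : (Fin n → ℝ) × ℝ}
    (h : ∀ᵐ x, x ∈ cube c.1 c.2 → G x = G' x) : fracAvg α G c = fracAvg α G' c := by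
  rw [fracAvg_eq, fracAvg_eq, setLIntegral_congr_fun_ae (measurableSet_cube _ _) h]

lemma maxFun_congr_ae (α : ℝ) {G G' : (Fin n → ℝ) → ℝ≥0∞} (h : G =ᵐ[volume] G') :
    maxFun α G = maxFun α G' := by
  ext x
  refine iSup_congr fun c => iSup_congr fun _ => iSup_congr fun _ => fracAvg_congr_ae α ?_
  filter_upwards [h] with x hx _ using hx

lemma maxFun_mono (α : ℝ) {G G' : (Fin n → ℝ) → ℝ≥0∞} (h : G ≤ G') :
    maxFun α G ≤ maxFun α G' := by
  intro x
  refine iSup_mono fun c => iSup_mono fun _ => iSup_mono fun _ => ?_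
  rw [fracAvg_eq, fracAvg_eq]
  gcongr
  exact h _

/-- The cubes `[-(N+1), N+1)^n`, which exhaust the space. -/
def exhaustingCube (n N : ℕ) : (Fin n → ℝ) × ℝ := (fun _ => -(N + 1 : ℝ), 2 * (N + 1 : ℝ))

lemma exhaustingCube_pos (n N : ℕ) : 0 < (exhaustingCube n N).2 := by
  simp only [exhaustingCube]
  positivity

lemma exhaustingCube_mono {M N : ℕ} (h : M ≤ N) :
    cube (exhaustingCube n M).1 (exhaustingCube n M).2 ⊆
      cube (exhaustingCube n N).1 (exhaustingCube n N).2 := by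
  intro x hx i
  have h1 := hx i
  have h2 : (M : ℝ) ≤ N := Nat.cast_le.2 h
  simp only [exhaustingCube] at h1 ⊢
  constructor <;> linarith

lemma exists_cube_subset_exhaustingCube (c : (Fin n → ℝ) × ℝ) :
    ∃ N : ℕ, cube c.1 c.2 ⊆ cube (exhaustingCube n N).1 (exhaustingCube n N).2 := by
  obtain ⟨N, hN⟩ := exists_nat_ge (‖c.1‖ + |c.2|)
  refine ⟨N, fun x hx i => ?_⟩
  have h1 := hx i
  have h2 := abs_le.1 ((Real.norm_eq_abs _).symm.trans_le (norm_le_pi_norm c.1 i))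
  have h3 := le_abs_self c.2
  have h4 := abs_nonneg c.2
  simp only [exhaustingCube]
  constructor <;> linarith

/-- Each competing cube lies in some exhausting cube. The shift `N₀` allows starting where the
exhausting cubes already carry mass of `u`. -/
lemma maxFun_eq_iSup_indicator (α : ℝ) (G : (Fin n → ℝ) → ℝ≥0∞) (N₀ : ℕ) (x : Fin n → ℝ) :
    maxFun α G x = ⨆ N : ℕ, maxFun α ((cube (exhaustingCube n (N + N₀)).1
      (exhaustingCube n (N + N₀)).2).indicator G) x := by
  refine le_antisymm (iSup₂_le fun c hc => iSup_le fun hx => ?_) (iSup_le fun N => ?_)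
  · obtain ⟨N, hN⟩ := exists_cube_subset_exhaustingCube c
    refine le_iSup_of_le N ?_
    refine le_trans (le_of_eq ?_) (fracAvg_le_maxFun hc hx)
    refine fracAvg_congr_ae α (ae_of_all _ fun y hy => ?_)
    exact (indicator_of_mem (exhaustingCube_mono (Nat.le_add_right N N₀) (hN hy)) G).symm
  · exact maxFun_mono α (indicator_le_self _ _) x

lemma exists_measure_inter_exhaustingCube_ne_zero {A : Set (Fin n → ℝ)} (hA : 0 < volume A) :
    ∃ N₀ : ℕ, ∀ N, N₀ ≤ N →
      volume (A ∩ cube (exhaustingCube n N).1 (exhaustingCube n N).2) ≠ 0 := by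
  have : ∃ N₀ : ℕ, volume (A ∩ cube (exhaustingCube n N₀).1 (exhaustingCube n N₀).2) ≠ 0 := by
    by_contra! h
    refine hA.ne' (measure_mono_null ?_ (measure_iUnion_null h))
    intro x hx
    obtain ⟨N, hN⟩ := exists_cube_subset_exhaustingCube ((x, 1) : (Fin n → ℝ) × ℝ)
    exact mem_iUnion.2 ⟨N, hx, hN fun i => ⟨le_rfl, lt_add_one _⟩⟩
  obtain ⟨N₀, h₀⟩ := this
  exact ⟨N₀, fun N hN h => h₀ (measure_mono_null
    (inter_subset_inter_right _ (exhaustingCube_mono hN)) h)⟩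

/-! ### The two weight inequality -/

/-- The constant in the two weight inequality. -/
noncomputable def bumpBound (n : ℕ) (p A : ℝ≥0∞) (r : ℝ) : ℝ≥0∞ :=
  -- In order: the level ratio, Hölder, `|5Q|^{1/p}` against `|Q|^{1/p}`, then inside the power
  -- sparsity, overlap, Vitali, truncation and the layer-cake integral.
  2 * 25 ^ n * ((5 ^ n + 1) * (5 ^ n) ^ r * (2 * (2 * (5 ^ n * (2 * (p * A))))) ^ r)

lemma bumpBound_ne_top (n : ℕ) {p A : ℝ≥0∞} (hp : p ≠ ∞) (hA : A ≠ ∞) {r : ℝ} (hr : 0 ≤ r) :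
    bumpBound n p A r ≠ ∞ := by
  unfold bumpBound
  have h1 : ((5 : ℝ≥0∞) ^ n) ^ r ≠ ∞ := ENNReal.rpow_ne_top_of_nonneg hr (by finiteness)
  have h2 : (2 * (2 * (5 ^ n * (2 * (p * A))))) ^ r ≠ ∞ :=
    ENNReal.rpow_ne_top_of_nonneg hr (by finiteness)
  finiteness

section

variable [NeZero n] {B : ℝ≥0 → ℝ≥0} {α p q : ℝ} {c₀ : ℝ≥0} {h s u : (Fin n → ℝ) → ℝ≥0} {K : ℝ≥0∞}

/-- The two weight inequality in terms of `h = |f| σ^{1/p}` and `s = σ^{1/p'}`, when `h s` is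
integrable. -/
lemma lintegral_maxFun_le_of_integrable (hB : Measurable B) (hα0 : 0 ≤ α) (hα : α < n)
    (hp : 0 < p) (hpq : p ≤ q) (hc0 : 0 < c₀) (hc : associate B c₀ ≤ 2⁻¹)
    (htail : tailInt (associate B) p c₀ < ∞)
    (hh : Measurable h) (hs : AEMeasurable s) (hu : AEMeasurable u) (hKt : K ≠ ∞)
    (hK : ∀ c : (Fin n → ℝ) × ℝ, 0 < c.2 →
      volume (cube c.1 c.2) ^ (α / n + 1 / q - 1 / p) *
      (⨍⁻ x in cube c.1 c.2, (u x : ℝ≥0∞) ∂volume) ^ (1 / q) *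
      luxemburgNorm B (cube c.1 c.2) (fun x => (s x : ℝ)) ≤ K)
    (hint : ∫⁻ x, (h x : ℝ≥0∞) ^ p < ∞) (hG : ∫⁻ x, (h x * s x : ℝ≥0∞) ≠ ∞) :
    ∫⁻ x, maxFun α (fun x => (h x * s x : ℝ≥0∞)) x ^ q * u x ≤
      (bumpBound n (ENNReal.ofReal p) (tailInt (associate B) p c₀) (1 / p) * K *
        (∫⁻ x, (h x : ℝ≥0∞) ^ p) ^ (1 / p)) ^ q := by
  have hq : 0 < q := hp.trans_le hpq
  refine (lintegral_maxFun_rpow_mul_le hα0 hα hG hq ((one_le_div hp).2 hpq) hu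
    (fun c => orliczNorm (associate B) (cube c.1 c.2) h ^ p)
    (fun c hcp => fracAvg_rpow_mul_le hB hα0 hp hq hs hKt hcp (hK _ (quint_pos hcp))
      (orliczNorm_lt_top (associate_mono B) hp hc0 hc htail hh hint _ hcp).ne)
    (fun ι _ Q hQ E hE hEQ hm => tsum_orliczNorm_rpow_mul_le (associate_mono B) hp hc0 hc hh Q hQ
      E hE hEQ 2 hm)).trans (le_of_eq ?_)
  set A := tailInt (associate B) p c₀
  set I := ∫⁻ x, (h x : ℝ≥0∞) ^ p
  have hp' : 0 ≤ 1 / p := by positivity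
  have e : ∀ y : ℝ≥0∞, y ^ (q / p) = (y ^ (1 / p)) ^ q := fun y => by
    rw [← ENNReal.rpow_mul]
    congr 1
    field_simp
  rw [e, ← mul_assoc 2 _ I, ENNReal.mul_rpow_of_nonneg _ I hp', ← ENNReal.mul_rpow_of_nonneg _ _ hq.le,
    ← ENNReal.mul_rpow_of_nonneg _ _ hq.le, bumpBound]
  congr 1
  ring

/-- The two weight inequality in terms of `h = |f| σ^{1/p}` and `s = σ^{1/p'}`. -/
lemma lintegral_maxFun_le (hB : Measurable B) (hα0 : 0 ≤ α) (hα : α < n)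
    (hp : 0 < p) (hpq : p ≤ q) (hc0 : 0 < c₀) (hc : associate B c₀ ≤ 2⁻¹)
    (htail : tailInt (associate B) p c₀ < ∞)
    (hh : Measurable h) (hs : AEMeasurable s) (hu : AEMeasurable u) (hu0 : 0 < volume {x | 0 < u x})
    (hKt : K ≠ ∞)
    (hK : ∀ c : (Fin n → ℝ) × ℝ, 0 < c.2 →
      volume (cube c.1 c.2) ^ (α / n + 1 / q - 1 / p) *
      (⨍⁻ x in cube c.1 c.2, (u x : ℝ≥0∞) ∂volume) ^ (1 / q) *
      luxemburgNorm B (cube c.1 c.2) (fun x => (s x : ℝ)) ≤ K)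
    (hint : ∫⁻ x, (h x : ℝ≥0∞) ^ p < ∞) :
    ∫⁻ x, maxFun α (fun x => (h x * s x : ℝ≥0∞)) x ^ q * u x ≤
      (bumpBound n (ENNReal.ofReal p) (tailInt (associate B) p c₀) (1 / p) * K *
        (∫⁻ x, (h x : ℝ≥0∞) ^ p) ^ (1 / p)) ^ q := by
  have hq : 0 < q := hp.trans_le hpq
  obtain ⟨N₀, hN₀⟩ := exists_measure_inter_exhaustingCube_ne_zero hu0
  set G : (Fin n → ℝ) → ℝ≥0∞ := fun x => (h x * s x : ℝ≥0∞) with hGdef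
  -- On these cubes `u` has positive mass, so finiteness of `K` forces a finite norm of `s`; Hölder
  -- then makes `h s` integrable on them.
  have hLux : ∀ N, N₀ ≤ N → luxemburgNorm B (cube (quint (exhaustingCube n N)).1
      (quint (exhaustingCube n N)).2) (fun x => (s x : ℝ)) ≠ ∞ := by
    intro N hN htop
    have hQ := exhaustingCube_pos n N
    have hle := hK _ (quint_pos hQ)
    have hV0 := (volume_cube_pos (quint (exhaustingCube n N)).1 (quint_pos hQ)).ne'
    have hVt := volume_cube_ne_top (quint (exhaustingCube n N)).1 (quint (exhaustingCube n N)).2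
    rw [htop, ENNReal.mul_top, top_le_iff] at hle
    · exact hKt hle
    · refine mul_ne_zero (ENNReal.rpow_pos (pos_iff_ne_zero.2 hV0) hVt).ne' ?_
      have hu1 : ∫⁻ x in cube (quint (exhaustingCube n N)).1 (quint (exhaustingCube n N)).2,
          (u x : ℝ≥0∞) ≠ 0 := by
        intro h0
        rw [lintegral_eq_zero_iff' hu.coe_nnreal_ennreal.restrict, EventuallyEq,
          ae_restrict_iff' (measurableSet_cube _ _), ae_iff] at h0
        refine hN₀ N hN (measure_mono_null ?_ h0)
        rintro x ⟨hx, hxc⟩ h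
        exact hx.ne' (by simpa using h (cube_subset_quint hQ hxc))
      have : ⨍⁻ x in cube (quint (exhaustingCube n N)).1 (quint (exhaustingCube n N)).2,
          (u x : ℝ≥0∞) ∂volume ≠ 0 := by
        rw [setLAverage_eq]
        exact (ENNReal.div_pos hu1 hVt).ne'
      simp [ENNReal.rpow_eq_zero_iff, this, hq, not_lt.2 hq.le]
  have hmain : ∀ N : ℕ, ∫⁻ x, maxFun α ((cube (exhaustingCube n (N + N₀)).1
      (exhaustingCube n (N + N₀)).2).indicator G) x ^ q * u x ≤
      (bumpBound n (ENNReal.ofReal p) (tailInt (associate B) p c₀) (1 / p) * K *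
        (∫⁻ x, (h x : ℝ≥0∞) ^ p) ^ (1 / p)) ^ q := by
    intro N
    set d := exhaustingCube n (N + N₀) with hd
    have hd0 : 0 < d.2 := exhaustingCube_pos _ _
    have hdm := measurableSet_cube d.1 d.2
    set h' : (Fin n → ℝ) → ℝ≥0 := (cube d.1 d.2).indicator h with hh'
    have hGh : (cube d.1 d.2).indicator G = fun x => (h' x * s x : ℝ≥0∞) := by
      ext x
      simp only [hh', indicator, hGdef]
      split_ifs <;> simp
    have hle : ∫⁻ x, (h' x : ℝ≥0∞) ^ p ≤ ∫⁻ x, (h x : ℝ≥0∞) ^ p := by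
      refine lintegral_mono fun x => ?_
      gcongr
      exact indicator_le_self' (fun _ _ => zero_le) x
    have hfin : ∫⁻ x, (h' x * s x : ℝ≥0∞) ≠ ∞ := by
      rw [← hGh, lintegral_indicator hdm]
      have hN := (orliczNorm_lt_top (associate_mono B) hp hc0 hc htail hh hint d.1 hd0).ne
      have hL := hLux (N + N₀) (Nat.le_add_left _ _)
      have h1 := laverage_mul_le hB hs hd0 hL hN
      rw [setLAverage_eq, ENNReal.div_le_iff (volume_cube_pos _ hd0).ne'
        (volume_cube_ne_top _ _)] at h1
      refine ne_top_of_le_ne_top ?_ h1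
      have := volume_cube_ne_top d.1 d.2
      finiteness
    rw [hGh]
    refine (lintegral_maxFun_le_of_integrable hB hα0 hα hp hpq hc0 hc htail (hh.indicator hdm) hs hu
      hKt hK (hle.trans_lt hint) hfin).trans ?_
    gcongr
  calc ∫⁻ x, maxFun α G x ^ q * u x
      = ∫⁻ x, ⨆ N : ℕ, maxFun α ((cube (exhaustingCube n (N + N₀)).1
          (exhaustingCube n (N + N₀)).2).indicator G) x ^ q * u x := by
        refine lintegral_congr fun x => ?_
        rw [maxFun_eq_iSup_indicator α G N₀ x, ← ENNReal.iSup_mul]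
        congr 1
        exact (ENNReal.orderIsoRpow q hq).map_iSup _
    _ = ⨆ N : ℕ, ∫⁻ x, maxFun α ((cube (exhaustingCube n (N + N₀)).1
          (exhaustingCube n (N + N₀)).2).indicator G) x ^ q * u x := by
        refine lintegral_iSup' (fun N => ((measurable_maxFun _ _).pow_const q).aemeasurable.mul
          hu.coe_nnreal_ennreal) (ae_of_all _ fun x M N hMN => ?_)
        dsimp only
        gcongr
        refine maxFun_mono α ?_ x
        exact indicator_le_indicator_of_subset
          (exhaustingCube_mono (by omega)) (fun _ => zero_le)
    _ ≤ _ := iSup_le hmain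

end

lemma enorm_coe_nnreal_rpow_rpow (y : ℝ≥0) {q : ℝ} (hq : 0 < q) :
    ‖(y : ℝ) ^ (1 / q)‖ₑ ^ q = (y : ℝ≥0∞) := by
  rw [← NNReal.coe_rpow, enorm_eq_nnnorm, NNReal.nnnorm_eq,
    ← ENNReal.coe_rpow_of_nonneg _ hq.le, ← NNReal.rpow_mul, one_div_mul_cancel hq.ne',
    NNReal.rpow_one]

end TwoWeight

theorem mainTheorem7 (n : ℕ) (p q : ℝ) (hp : 1 < p) (hpq : p ≤ q)
    (B : ℝ≥0 → ℝ≥0) (hB : TwoWeight.IsYoungFunction B)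
    (hBp : TwoWeight.SatisfiesBp (TwoWeight.associate B) p) :
    ∃ C : ℝ≥0, ∀ α : ℝ, 0 ≤ α → α < n → ∀ u σ : (Fin n → ℝ) → ℝ≥0,
      TwoWeight.IsWeight u → TwoWeight.IsWeight σ →
      TwoWeight.bumpConst α p q B u σ < ∞ →
      ∀ f : (Fin n → ℝ) → ℝ, MemLp f (ENNReal.ofReal p) (TwoWeight.weightMeasure σ) →
        (∫⁻ x, TwoWeight.fracMaximal α (fun y => f y * σ y) x ^ q * u x) ^ (1 / q)
          ≤ C * TwoWeight.bumpConst α p q B u σ * (∫⁻ x, ‖f x‖ₑ ^ p * σ x) ^ (1 / p) := by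
  open TwoWeight in
  have hp0 : 0 < p := zero_lt_one.trans hp
  have hq0 : 0 < q := hp0.trans_le hpq
  obtain ⟨c₀, hc0, hc1, hc⟩ := exists_associate_le_half hB.tendsto_div
  have htail := tailInt_lt_top hp0 (associate_mono B) (associate_one_lt_top hB.tendsto_div) hBp
    hc0 hc1
  have hCt := bumpBound_ne_top n (ENNReal.ofReal_ne_top (r := p)) htail.ne (one_div_pos.2 hp0).le
  refine ⟨(bumpBound n (ENNReal.ofReal p) (tailInt (associate B) p c₀) (1 / p)).toNNReal, ?_⟩
  rw [ENNReal.coe_toNNReal hCt]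
  intro α hα0 hα u σ hu hσ hK f hf
  -- The range `0 ≤ α < n` is empty for `n = 0`.
  have hn : NeZero n := ⟨by
    rintro rfl
    rw [Nat.cast_zero] at hα
    exact absurd hα0 (not_le.2 hα)⟩
  have hσe := hσ.aemeasurable.coe_nnreal_ennreal
  obtain ⟨g, hg, hfg⟩ := hf.aestronglyMeasurable
  have hfg' : ∀ᵐ x, (σ x : ℝ≥0∞) ≠ 0 → f x = g x := (ae_withDensity_iff' hσe).1 hfg
  have hsum : 1 / p + 1 / p.conjExponent = 1 := by
    have : p - 1 ≠ 0 := by linarith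
    rw [Real.conjExponent]
    field_simp
    ring
  have hp' : 0 ≤ 1 / p.conjExponent := by
    rw [Real.conjExponent]
    have : 0 < p - 1 := by linarith
    positivity
  set s : (Fin n → ℝ) → ℝ≥0 := fun x => σ x ^ (1 / p.conjExponent) with hs
  -- The embedding needs a genuinely measurable `h`, hence the representatives. `f` and `g` may
  -- differ where `σ = 0`, but there the factor `σ^{1/p}` vanishes.
  set h : (Fin n → ℝ) → ℝ≥0 := fun x => ‖g x‖₊ * hσ.aemeasurable.mk σ x ^ (1 / p) with hh
  have hhm : Measurable h :=
    hg.measurable.nnnorm.mul (hσ.aemeasurable.measurable_mk.pow_const _)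
  have hsm : AEMeasurable s := hσ.aemeasurable.pow_const _
  have hh_ae : ∀ᵐ x, h x = ‖f x‖₊ * σ x ^ (1 / p) := by
    filter_upwards [hfg', hσ.aemeasurable.ae_eq_mk] with x hx hx'
    by_cases h0 : σ x = 0
    · simp [hh, ← hx', h0, hp0.ne']
    · simp only [hh, ← hx', hx (by simpa using h0)]
  have hGs : (fun y => ‖f y * σ y‖ₑ) =ᵐ[volume] fun x => (h x * s x : ℝ≥0∞) := by
    filter_upwards [hh_ae] with x hx
    rw [hx, enorm_eq_nnnorm, nnnorm_mul, NNReal.nnnorm_eq, ← ENNReal.coe_mul, mul_assoc,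
      ← NNReal.rpow_add_of_nonneg _ (by positivity) hp', hsum, NNReal.rpow_one]
  have hhp : ∫⁻ x, (h x : ℝ≥0∞) ^ p = ∫⁻ x, ‖f x‖ₑ ^ p * σ x := by
    refine lintegral_congr_ae ?_
    filter_upwards [hh_ae] with x hx
    rw [hx, ENNReal.coe_mul, ENNReal.mul_rpow_of_nonneg _ _ hp0.le,
      ← ENNReal.coe_rpow_of_nonneg (σ x ^ (1 / p)) hp0.le, ← NNReal.rpow_mul,
      one_div_mul_cancel hp0.ne', NNReal.rpow_one, enorm_eq_nnnorm]
  have hint : ∫⁻ x, (h x : ℝ≥0∞) ^ p < ∞ := by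
    have h1 := lintegral_rpow_enorm_lt_top_of_eLpNorm_lt_top (by simpa using hp0)
      ENNReal.ofReal_ne_top hf.2
    rw [ENNReal.toReal_ofReal hp0.le, weightMeasure, lintegral_withDensity_eq_lintegral_mul₀' hσe
      (hf.1.enorm.pow_const p)] at h1
    rw [hhp]
    simpa only [Pi.mul_apply, mul_comm] using h1
  have hbump : ∀ c : (Fin n → ℝ) × ℝ, 0 < c.2 →
      volume (cube c.1 c.2) ^ (α / n + 1 / q - 1 / p) *
      (⨍⁻ x in cube c.1 c.2, (u x : ℝ≥0∞) ∂volume) ^ (1 / q) *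
      luxemburgNorm B (cube c.1 c.2) (fun x => (s x : ℝ)) ≤ bumpConst α p q B u σ := by
    intro c hc
    refine le_trans (le_of_eq ?_) (le_iSup₂_of_le c.1 c.2 (le_iSup_of_le hc le_rfl))
    simp only [normLp, enorm_coe_nnreal_rpow_rpow _ hq0, hs, NNReal.coe_rpow]
  have hmain := lintegral_maxFun_le hB.continuous.measurable hα0 hα hp0 hpq hc0 hc htail hhm hsm
    hu.aemeasurable hu.pos hK.ne hbump hint
  rw [hhp, ← maxFun_congr_ae α hGs] at hmain
  simp only [fracMaximal_eq_maxFun]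
  rw [one_div q, ENNReal.rpow_inv_le_iff hq0]
  exact hmain
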